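/- Write $\mathbb N=\{0,1,2,\dots\}$. A Pisot number is a real algebraic integer $\beta>1$ all of whose conjugates other than $\beta$ have modulus less than $1$; a Salem number is a real algebraic integer $\beta>1$ all of whose conjugates other than $\beta$ have modulus at most $1$, at least one of them having modulus equal to $1$. For $\rho>1$ put $\gamma(\rho;X)=\sum_{m=0}^{\infty}X^{\lfloor m^{\rho}\rfloor}$. For a power series $g(X)=\sum_{n\ge 0}t_nX^n$ put $S(g)=\{n\in\mathbb N : t_n\neq 0\}$ and $\lambda(S(g);R)=\mathrm{Card}(S(g)\cap[0,R))$. Let $\mathcal F$ be the set of power series $g(X)$ that are not polynomials and satisfy: (1) the coefficients of $g$ are bounded nonnegative integers; (2) for every $\varepsilon>0$, $\lambda(S(g);R)=o(R^{\varepsilon})$ as $R\to\infty$; (3) there is a constant $C>0$ such that $[R,CR]\cap S(g)\neq\emptyset$ for all sufficiently large real $R$. For every integer $k\ge 3$ the polynomial $G_k(X)=(1-X)^k+(k-1)X-1$ has exactly one zero in the open interval $(0,1)$; denote it by $\sigma_k$. Theorem. Let $A$ be a positive integer and $\rho$ a real number such that $\rho>A$ if $A\le 3$, and $\rho>\sigma_A^{-1}$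 if $A\ge 4$. Then, for every $g\in\mathcal F$ and every Pisot or Salem number $\beta$, the numbers $$\gamma(\rho;\beta^{-1})^{k_1}\,g(\beta^{-1})^{k_2}\qquad(k_1,k_2\in\mathbb N,\ k_1\le A),$$ regarded as a family indexed by the pairs $(k_1,k_2)$, are linearly independent over $\mathbb Q(\beta)$. -/

import Mathlib

namespace BetaSeries

/-- The support `S(f)`: indices of the nonzero coefficients of a formal power series. -/
def support (f : PowerSeries ℤ) : Set ℕ :=
  {n | PowerSeries.coeff n f ≠ 0}

/-- The counting function `λ(𝒜; R) = Card (𝒜 ∩ [0, R))`, for real `R`. -/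
noncomputable def count (𝒜 : Set ℕ) (R : ℝ) : ℕ :=
  Set.ncard {n : ℕ | n ∈ 𝒜 ∧ (n : ℝ) < R}

/-- The value `f(x)` of a power series at a real number `x`
(it is only used where the series converges absolutely). -/
noncomputable def value (f : PowerSeries ℤ) (x : ℝ) : ℝ :=
  ∑' n : ℕ, ((PowerSeries.coeff n f : ℤ) : ℝ) * x ^ n

/-- The value at `x` of the series `γ(ρ; X) = ∑_{m ≥ 0} X ^ ⌊m ^ ρ⌋`. -/
noncomputable def gamma (ρ x : ℝ) : ℝ :=
  ∑' m : ℕ, x ^ ⌊(m : ℝ) ^ ρ⌋₊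

/-- The class `𝓕` of nonpolynomial power series. -/
structure InClassF (g : PowerSeries ℤ) : Prop where
  /-- `g` is not a polynomial. -/
  nonpolynomial : ∀ p : Polynomial ℤ, (p : PowerSeries ℤ) ≠ g
  /-- The coefficients are bounded nonnegative integers. -/
  bounded : ∃ B : ℤ, ∀ n : ℕ, 0 ≤ PowerSeries.coeff n g ∧ PowerSeries.coeff n g ≤ B
  /-- `λ(S(g); R) = o(R ^ ε)` as `R → ∞`, for every `ε > 0`. -/
  sparse : ∀ ε : ℝ, 0 < ε →
    (fun R : ℝ => (count (support g) R : ℝ)) =o[Filter.atTop] (fun R : ℝ => R ^ ε)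
  /-- `[R, C R]` meets `S(g)` for all sufficiently large real `R`. -/
  meets : ∃ C : ℝ, 0 < C ∧ ∀ᶠ R : ℝ in Filter.atTop,
    (Set.Icc R (C * R) ∩ ((fun n : ℕ => (n : ℝ)) '' support g)).Nonempty

/-- Pisot numbers: algebraic integers greater than `1` all of whose other conjugates have modulus
less than `1`. -/
def IsPisot (β : ℝ) : Prop :=
  IsIntegral ℤ β ∧ 1 < β ∧ ∀ z : ℂ, IsConjRoot ℚ (β : ℂ) z → z ≠ (β : ℂ) → ‖z‖ < 1

/-- Salem numbers: algebraic integers greater than `1` all of whose other conjugates have modulus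
at most `1`, with at least one conjugate of modulus exactly `1`. -/
def IsSalem (β : ℝ) : Prop :=
  IsIntegral ℤ β ∧ 1 < β ∧ (∀ z : ℂ, IsConjRoot ℚ (β : ℂ) z → z ≠ (β : ℂ) → ‖z‖ ≤ 1) ∧
    ∃ z : ℂ, IsConjRoot ℚ (β : ℂ) z ∧ ‖z‖ = 1

/-- `G_k(X) = (1 - X) ^ k + (k - 1) X - 1`. -/
noncomputable def G (k : ℕ) (x : ℝ) : ℝ :=
  (1 - x) ^ k + ((k : ℝ) - 1) * x - 1

/-- The zero `σ_k` of `G_k` in `(0, 1)`; for `k ≥ 3` the set below has exactly one element, see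
`existsUnique_zero_G` and `sigma_spec`. -/
noncomputable def sigma (k : ℕ) : ℝ :=
  sInf {x : ℝ | x ∈ Set.Ioo (0 : ℝ) 1 ∧ G k x = 0}

theorem existsUnique_zero_G {k : ℕ} (hk : 3 ≤ k) :
    ∃! x : ℝ, x ∈ Set.Ioo (0 : ℝ) 1 ∧ G k x = 0 := by
  have hk3 : (3 : ℝ) ≤ k := by exact_mod_cast hk
  -- strict convexity of `G k` on `[0, 1]`, used against the zero at `0`
  have key : ∀ x y : ℝ, 0 < x → x < y → y < 1 → G k x = 0 → G k y = 0 → False := by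
    intro x y hx hxy hy hGx hGy
    have hy0 : 0 < y := hx.trans hxy
    have hsc := (strictConvexOn_pow (n := k) (by omega)).2
      (show (1 : ℝ) ∈ Set.Ici 0 by simp) (show (1 - y) ∈ Set.Ici (0 : ℝ) by
        simp only [Set.mem_Ici]; linarith) (by linarith : (1 : ℝ) ≠ 1 - y)
      (show 0 < 1 - x / y by rw [sub_pos, div_lt_one hy0]; exact hxy)
      (show 0 < x / y by positivity) (by ring)
    simp only [smul_eq_mul, one_pow, mul_one] at hsc
    have e1 : 1 - x / y + x / y * (1 - y) = 1 - x := by field_simp; ring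
    rw [e1] at hsc
    unfold G at hGx hGy
    have e2 : (1 - y) ^ k = 1 - ((k : ℝ) - 1) * y := by linarith
    have e3 : x / y * (1 - ((k : ℝ) - 1) * y) = x / y - ((k : ℝ) - 1) * x := by field_simp
    rw [e2, e3] at hsc
    linarith
  have hk0 : (0 : ℝ) < k := by linarith
  set a : ℝ := 1 / (k : ℝ) ^ 2 with ha
  have ha0 : 0 < a := by positivity
  have hak : (k : ℝ) ^ 2 * a = 1 := by rw [ha]; field_simp
  have ha1 : a < 1 := by nlinarith
  have hneg : G k a < 0 := by
    have hb : 1 + (k : ℝ) * a ≤ (1 + a) ^ k := one_add_mul_le_pow (by linarith) k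
    have hp0 : 0 ≤ (1 - a) ^ k := pow_nonneg (by linarith) k
    have hp : (1 - a) ^ k * (1 + a) ^ k ≤ 1 := by
      rw [← mul_pow]
      exact pow_le_one₀ (by nlinarith) (by nlinarith)
    have h1 : (1 - a) ^ k * (1 + k * a) ≤ 1 :=
      (mul_le_mul_of_nonneg_left hb hp0).trans hp
    unfold G
    by_contra hcon
    have h2 : 1 - ((k : ℝ) - 1) * a ≤ (1 - a) ^ k := by linarith
    have h3 : (1 - ((k : ℝ) - 1) * a) * (1 + k * a) ≤ 1 :=
      (mul_le_mul_of_nonneg_right h2 (by positivity)).trans h1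
    have h4 : (1 - ((k : ℝ) - 1) * a) * (1 + k * a)
        = 1 + a - ((k : ℝ) ^ 2 * a) * a + k * a * a := by ring
    rw [h4, hak] at h3
    have : 0 < (k : ℝ) * a * a := by positivity
    linarith
  have hpos : 0 < G k 1 := by
    unfold G
    rw [sub_self, zero_pow (by omega)]
    linarith
  have hcont : ContinuousOn (G k) (Set.Icc a 1) := by
    unfold G
    fun_prop
  obtain ⟨c, hc, hc0⟩ := intermediate_value_Ioo ha1.le hcont ⟨hneg, hpos⟩
  refine ⟨c, ⟨⟨ha0.trans hc.1, hc.2⟩, hc0⟩, ?_⟩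
  rintro y ⟨⟨hy0, hy1⟩, hGy⟩
  rcases lt_trichotomy y c with h | h | h
  · exact (key y c hy0 h hc.2 hGy hc0).elim
  · exact h
  · exact (key c y (ha0.trans hc.1) h hy1 hc0 hGy).elim

theorem sigma_spec {k : ℕ} (hk : 3 ≤ k) :
    sigma k ∈ Set.Ioo (0 : ℝ) 1 ∧ G k (sigma k) = 0 := by
  obtain ⟨c, hc, huniq⟩ := existsUnique_zero_G hk
  have : {x : ℝ | x ∈ Set.Ioo (0 : ℝ) 1 ∧ G k x = 0} = {c} :=
    Set.eq_singleton_iff_unique_mem.mpr ⟨hc, huniq⟩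
  have hs : sigma k = c := by rw [sigma, this, csInf_singleton]
  rw [hs]
  exact hc

end BetaSeries

/-! Write f for the power series of γ(ρ; X) and x = 1/ρ. Clear denominators in a nontrivial relation
and multiply it by a monomial in f and g so that its lexicographically largest term is f^A g^D with
D ≥ 1. Let u n be the resulting coefficient of β^(-n), and y R = ∑_{n ≤ R} u n β^(R-n), so that y
(R+1) = β y R + u (R+1). As the whole series vanishes, y R is minus a rescaled tail, hence of
polynomial size. It is also an algebraic integer whose other conjugates are of polynomial size, so a
nonzero y R is at least the inverse of a polynomial in R (`exists_bounds_head_relCoeff`). Since y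
grows like β^M along a stretch of M zeros of u, every R with y R ≠ 0 has an exponent of the relation
shortly after it. These exponents number at most N^(Ax + o(1)) up to N, and Ax < 1, so y R ≠ 0 is
rare.

On the other hand y R ≠ 0 is frequent. Let W be the exponents of the f^A g^j with j < D. In a long
gap of W that avoids all terms of lower degree in f, only f^A g^D contributes, with one sign. Adding
an element of S(g) of size comparable to the gap to its left end w gives an exponent of f^A g^D
inside the gap. If y vanished before it, y would be exponentially large at the end of the gap. So y
R ≠ 0 on a fixed proportion of the gap, at its start (`exists_mem_fullSupport_of_gap`).

It remains to see that such gaps cover most of [0, N) (`le_card_of_consecutive_gaps`). Greedy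
approximation by S(f^A) bounds the gaps of W by N^((1-x)^A), up to a constant, so gaps spoilt by
lower terms cover at most N^((A-1)x + (1-x)^A + o(1)) integers. This is o(N) exactly because G_A(x)
< 0, which is what the hypothesis on ρ provides (`exponent_bounds`). -/

namespace BetaSeries

/-! ### Power series with nonnegative or polynomially bounded coefficients, their supports and
values -/

/-- All coefficients are nonnegative. -/
def NonnegCoeff (f : PowerSeries ℤ) : Prop :=
  ∀ n, 0 ≤ PowerSeries.coeff n f

/-- The coefficients grow at most polynomially. -/
def PolyBounded (f : PowerSeries ℤ) : Prop :=
  ∃ (C : ℝ) (e : ℕ), 0 ≤ C ∧ ∀ n : ℕ, |((PowerSeries.coeff n f : ℤ) : ℝ)| ≤ C * ((n : ℝ) + 1) ^ e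

theorem NonnegCoeff.one : NonnegCoeff 1 := by
  intro n
  rw [PowerSeries.coeff_one]
  split_ifs <;> simp

theorem NonnegCoeff.mul {f g : PowerSeries ℤ} (hf : NonnegCoeff f) (hg : NonnegCoeff g) :
    NonnegCoeff (f * g) := by
  intro n
  rw [PowerSeries.coeff_mul]
  exact Finset.sum_nonneg fun p _ => mul_nonneg (hf _) (hg _)

theorem NonnegCoeff.pow {f : PowerSeries ℤ} (hf : NonnegCoeff f) (k : ℕ) : NonnegCoeff (f ^ k) := by
  induction k with
  | zero => simpa using NonnegCoeff.one
  | succ k ih => rw [pow_succ]; exact ih.mul hf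

theorem PolyBounded.one : PolyBounded 1 := by
  refine ⟨1, 0, zero_le_one, fun n => ?_⟩
  rw [PowerSeries.coeff_one]
  split_ifs <;> simp

theorem PolyBounded.mul {f g : PowerSeries ℤ} (hf : PolyBounded f) (hg : PolyBounded g) :
    PolyBounded (f * g) := by
  obtain ⟨C, e, hC, hf⟩ := hf
  obtain ⟨C', e', hC', hg⟩ := hg
  refine ⟨C * C', e + e' + 1, by positivity, fun n => ?_⟩
  rw [PowerSeries.coeff_mul]
  push_cast
  calc |∑ p ∈ Finset.HasAntidiagonal.antidiagonal n, ((PowerSeries.coeff p.1 f : ℤ) : ℝ) *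
          ((PowerSeries.coeff p.2 g : ℤ) : ℝ)|
      ≤ ∑ p ∈ Finset.HasAntidiagonal.antidiagonal n, |((PowerSeries.coeff p.1 f : ℤ) : ℝ) *
          ((PowerSeries.coeff p.2 g : ℤ) : ℝ)| := Finset.abs_sum_le_sum_abs _ _
    _ ≤ ∑ p ∈ Finset.HasAntidiagonal.antidiagonal n, (C * ((n : ℝ) + 1) ^ e) * (C' * ((n : ℝ) + 1) ^ e') := by
        refine Finset.sum_le_sum fun p hp => ?_
        have hp' := Finset.HasAntidiagonal.mem_antidiagonal.1 hp
        have h1 : (p.1 : ℝ) ≤ n := by exact_mod_cast (by omega : p.1 ≤ n)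
        have h2 : (p.2 : ℝ) ≤ n := by exact_mod_cast (by omega : p.2 ≤ n)
        rw [abs_mul]
        refine mul_le_mul ((hf _).trans ?_) ((hg _).trans ?_) (abs_nonneg _) (by positivity)
        · gcongr
        · gcongr
    _ = C * C' * ((n : ℝ) + 1) ^ (e + e' + 1) := by
        rw [Finset.sum_const, Finset.Nat.card_antidiagonal, nsmul_eq_mul]
        push_cast
        ring

theorem PolyBounded.pow {f : PowerSeries ℤ} (hf : PolyBounded f) (k : ℕ) : PolyBounded (f ^ k) := by
  induction k with
  | zero => simpa using PolyBounded.one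
  | succ k ih => rw [pow_succ]; exact ih.mul hf

theorem PolyBounded.of_bounded {f : PowerSeries ℤ} {B : ℤ}
    (hf : ∀ n, 0 ≤ PowerSeries.coeff n f ∧ PowerSeries.coeff n f ≤ B) : PolyBounded f := by
  refine ⟨B, 0, by exact_mod_cast (hf 0).1.trans (hf 0).2, fun n => ?_⟩
  rw [abs_of_nonneg (by exact_mod_cast (hf n).1)]
  simpa using (by exact_mod_cast (hf n).2 : ((PowerSeries.coeff n f : ℤ) : ℝ) ≤ B)

/-- Nonnegativity rules out cancellation in the Cauchy product. -/
theorem add_mem_support_mul {f g : PowerSeries ℤ} (hf : NonnegCoeff f) (hg : NonnegCoeff g)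
    {a b : ℕ} (ha : a ∈ support f) (hb : b ∈ support g) : a + b ∈ support (f * g) := by
  have ha' : 0 < PowerSeries.coeff a f := lt_of_le_of_ne (hf a) (Ne.symm ha)
  have hb' : 0 < PowerSeries.coeff b g := lt_of_le_of_ne (hg b) (Ne.symm hb)
  change PowerSeries.coeff (a + b) (f * g) ≠ 0
  rw [PowerSeries.coeff_mul]
  refine (lt_of_lt_of_le (mul_pos ha' hb') ?_).ne'
  exact Finset.single_le_sum (f := fun p : ℕ × ℕ => PowerSeries.coeff p.1 f * PowerSeries.coeff p.2 g)
    (fun p _ => mul_nonneg (hf _) (hg _)) (Finset.HasAntidiagonal.mem_antidiagonal.2 (rfl : (a, b).1 + (a, b).2 = _))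

theorem exists_add_of_mem_support_mul {f g : PowerSeries ℤ} {n : ℕ} (hn : n ∈ support (f * g)) :
    ∃ a ∈ support f, ∃ b ∈ support g, a + b = n := by
  change PowerSeries.coeff n (f * g) ≠ 0 at hn
  rw [PowerSeries.coeff_mul] at hn
  obtain ⟨p, hp, hne⟩ := Finset.exists_ne_zero_of_sum_ne_zero hn
  exact ⟨p.1, left_ne_zero_of_mul hne, p.2, right_ne_zero_of_mul hne, Finset.HasAntidiagonal.mem_antidiagonal.1 hp⟩

open Classical in
/-- The elements of a set of natural numbers below `N`. -/
noncomputable def below (S : Set ℕ) (N : ℕ) : Finset ℕ :=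
  (Finset.range N).filter (· ∈ S)

theorem mem_below {S : Set ℕ} {N n : ℕ} : n ∈ below S N ↔ n < N ∧ n ∈ S := by
  simp [below]

theorem card_below_eq_count (S : Set ℕ) (N : ℕ) : (below S N).card = count S N := by
  rw [count, ← Set.ncard_coe_finset]
  congr 1
  ext n
  simp [mem_below, and_comm]

theorem card_below_mul_le (f g : PowerSeries ℤ) (N : ℕ) :
    (below (support (f * g)) N).card ≤ (below (support f) N).card * (below (support g) N).card := by
  rw [← Finset.card_product]
  refine (Finset.card_le_card fun n hn => ?_).trans
    (Finset.card_image_le (f := fun p : ℕ × ℕ => p.1 + p.2))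
  obtain ⟨hnN, hn⟩ := mem_below.1 hn
  obtain ⟨a, ha, b, hb, rfl⟩ := exists_add_of_mem_support_mul hn
  exact Finset.mem_image.2 ⟨(a, b), Finset.mem_product.2
    ⟨mem_below.2 ⟨by omega, ha⟩, mem_below.2 ⟨by omega, hb⟩⟩, rfl⟩

theorem card_below_one_le (N : ℕ) : (below (support 1) N).card ≤ 1 := by
  refine Finset.card_le_one.2 ?_
  have : ∀ a ∈ below (support 1) N, a = 0 := by
    intro a ha
    by_contra h
    exact (mem_below.1 ha).2 (by rw [PowerSeries.coeff_one, if_neg h])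
  intro a ha b hb
  rw [this a ha, this b hb]

theorem card_below_pow_le (f : PowerSeries ℤ) (k N : ℕ) :
    (below (support (f ^ k)) N).card ≤ (below (support f) N).card ^ k := by
  induction k with
  | zero => simpa using card_below_one_le N
  | succ k ih =>
    rw [pow_succ, pow_succ]
    exact (card_below_mul_le _ _ _).trans (Nat.mul_le_mul_right _ ih)

theorem card_below_pow_mul_pow_le (f g : PowerSeries ℤ) (i j N : ℕ) :
    (below (support (f ^ i * g ^ j)) N).card ≤
      (below (support f) N).card ^ i * (below (support g) N).card ^ j :=
  (card_below_mul_le _ _ _).trans (Nat.mul_le_mul (card_below_pow_le _ _ _) (card_below_pow_le _ _ _))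

theorem summable_add_one_pow_mul_geometric (e : ℕ) {x : ℝ} (hx0 : 0 < x) (hx1 : x < 1) :
    Summable fun n : ℕ => ((n : ℝ) + 1) ^ e * x ^ n := by
  have h := (summable_nat_add_iff 1).2
    (summable_pow_mul_geometric_of_norm_lt_one (R := ℝ) e (r := x) (by rwa [Real.norm_of_nonneg hx0.le]))
  have h2 := h.mul_left x⁻¹
  refine h2.congr fun n => ?_
  push_cast
  rw [pow_succ]
  field_simp

theorem PolyBounded.summable {f : PowerSeries ℤ} (hf : PolyBounded f) {x : ℝ} (hx0 : 0 < x)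
    (hx1 : x < 1) : Summable fun n : ℕ => ‖((PowerSeries.coeff n f : ℤ) : ℝ) * x ^ n‖ := by
  obtain ⟨C, e, hC, hf⟩ := hf
  refine Summable.of_nonneg_of_le (fun n => norm_nonneg _) (fun n => ?_)
    ((summable_add_one_pow_mul_geometric e hx0 hx1).mul_left C)
  rw [norm_mul, Real.norm_eq_abs, Real.norm_of_nonneg (by positivity : 0 ≤ x ^ n), ← mul_assoc]
  exact mul_le_mul_of_nonneg_right (hf n) (by positivity)

theorem value_mul {f g : PowerSeries ℤ} (hf : PolyBounded f) (hg : PolyBounded g) {x : ℝ}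
    (hx0 : 0 < x) (hx1 : x < 1) : value (f * g) x = value f x * value g x := by
  unfold value
  rw [tsum_mul_tsum_eq_tsum_sum_antidiagonal_of_summable_norm (hf.summable hx0 hx1)
    (hg.summable hx0 hx1)]
  refine tsum_congr fun n => ?_
  rw [PowerSeries.coeff_mul]
  push_cast
  rw [Finset.sum_mul]
  refine Finset.sum_congr rfl fun p hp => ?_
  rw [← Finset.HasAntidiagonal.mem_antidiagonal.1 hp, pow_add]
  ring

theorem value_one (x : ℝ) : value 1 x = 1 := by
  unfold value
  rw [tsum_eq_single 0]
  · simp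
  · intro n hn
    rw [PowerSeries.coeff_one, if_neg hn]
    simp

theorem value_pow {f : PowerSeries ℤ} (hf : PolyBounded f) {x : ℝ} (hx0 : 0 < x) (hx1 : x < 1)
    (k : ℕ) : value (f ^ k) x = value f x ^ k := by
  induction k with
  | zero => simpa using value_one x
  | succ k ih => rw [pow_succ, pow_succ, value_mul (hf.pow k) hf hx0 hx1, ih]

end BetaSeries

/-! ### The series γ(ρ; X): density and gaps of its exponents -/

namespace BetaSeries

/-- Superadditivity of t ↦ t^ρ separates consecutive values by at least 1. Hence the exponents of γ
do not repeat and its coefficients are 0 or 1. -/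
theorem strictMono_floor_rpow {ρ : ℝ} (hρ : 1 ≤ ρ) : StrictMono fun m : ℕ => ⌊(m : ℝ) ^ ρ⌋₊ := by
  refine strictMono_nat_of_lt_succ fun m => ?_
  have h := Real.add_rpow_le_rpow_add (Nat.cast_nonneg m) (zero_le_one' ℝ) hρ
  rw [Real.one_rpow] at h
  have h2 := Nat.floor_le (a := (m : ℝ) ^ ρ) (by positivity)
  refine Nat.lt_of_succ_le (Nat.le_floor ?_)
  push_cast
  linarith

open Classical in
/-- The power series `γ(ρ; X)`. -/
noncomputable def gammaSeries (ρ : ℝ) : PowerSeries ℤ :=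
  PowerSeries.mk fun n => if n ∈ Set.range fun m : ℕ => ⌊(m : ℝ) ^ ρ⌋₊ then 1 else 0

theorem coeff_gammaSeries_bounds (ρ : ℝ) (n : ℕ) : 0 ≤ PowerSeries.coeff n (gammaSeries ρ) ∧
    PowerSeries.coeff n (gammaSeries ρ) ≤ 1 := by
  rw [gammaSeries, PowerSeries.coeff_mk]
  split_ifs <;> simp

theorem support_gammaSeries (ρ : ℝ) :
    support (gammaSeries ρ) = Set.range fun m : ℕ => ⌊(m : ℝ) ^ ρ⌋₊ := by
  ext n
  simp [support, gammaSeries, PowerSeries.coeff_mk]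

theorem value_gammaSeries {ρ : ℝ} (hρ : 1 ≤ ρ) (x : ℝ) : value (gammaSeries ρ) x = gamma ρ x := by
  unfold value gamma
  rw [← (strictMono_floor_rpow hρ).injective.tsum_eq
    (f := fun n : ℕ => ((PowerSeries.coeff n (gammaSeries ρ) : ℤ) : ℝ) * x ^ n)]
  · refine tsum_congr fun m => ?_
    have : PowerSeries.coeff ⌊(m : ℝ) ^ ρ⌋₊ (gammaSeries ρ) = 1 := by
      rw [gammaSeries, PowerSeries.coeff_mk, if_pos ⟨m, rfl⟩]
    simp [this]
  · intro n hn
    rw [← support_gammaSeries]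
    intro h
    exact hn (by simp [h])

theorem card_below_gammaSeries_le {ρ : ℝ} (hρ : 1 ≤ ρ) {N : ℕ} (hN : 1 ≤ N) :
    ((below (support (gammaSeries ρ)) N).card : ℝ) ≤ 2 * (N : ℝ) ^ ρ⁻¹ := by
  have hρ0 : 0 < ρ := by linarith
  have hN' : (1 : ℝ) ≤ (N : ℝ) ^ ρ⁻¹ :=
    Real.one_le_rpow (by exact_mod_cast hN) (by positivity)
  have hsub : below (support (gammaSeries ρ)) N ⊆
      (Finset.range ⌈(N : ℝ) ^ ρ⁻¹⌉₊).image fun m : ℕ => ⌊(m : ℝ) ^ ρ⌋₊ := by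
    intro n hn
    obtain ⟨hnN, hn⟩ := mem_below.1 hn
    rw [support_gammaSeries] at hn
    obtain ⟨m, rfl⟩ := hn
    refine Finset.mem_image.2 ⟨m, Finset.mem_range.2 (Nat.lt_ceil.2 ?_), rfl⟩
    have h1 : (m : ℝ) ^ ρ < N := (Nat.floor_lt (by positivity)).1 hnN
    have h2 := Real.rpow_lt_rpow (by positivity) h1 (inv_pos.2 hρ0)
    rwa [Real.rpow_rpow_inv (by positivity) hρ0.ne'] at h2
  have h1 : (below (support (gammaSeries ρ)) N).card ≤ ⌈(N : ℝ) ^ ρ⁻¹⌉₊ :=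
    (Finset.card_le_card hsub).trans (Finset.card_image_le.trans (by simp))
  have h2 := Nat.ceil_lt_add_one (a := (N : ℝ) ^ ρ⁻¹) (by positivity)
  have h3 : ((below (support (gammaSeries ρ)) N).card : ℝ) ≤ ⌈(N : ℝ) ^ ρ⁻¹⌉₊ := by exact_mod_cast h1
  linarith

/-- Bernoulli's inequality: the convex function t^ρ lies above its tangent at y. -/
theorem rpow_sub_rpow_le {ρ y m : ℝ} (hρ : 1 ≤ ρ) (hy : 0 < y) (hm : 0 ≤ m) :
    y ^ ρ - m ^ ρ ≤ ρ * y ^ (ρ - 1) * (y - m) := by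
  have h := one_add_mul_self_le_rpow_one_add (s := m / y - 1) (by
    have : 0 ≤ m / y := by positivity
    linarith) hρ
  rw [add_sub_cancel, Real.div_rpow hm hy.le, le_div_iff₀ (by positivity)] at h
  rw [Real.rpow_sub_one hy.ne']
  have e : (1 + ρ * (m / y - 1)) * y ^ ρ = y ^ ρ - ρ * (y ^ ρ / y) * (y - m) := by
    field_simp
    ring
  linarith

theorem exists_mem_support_gammaSeries_near {ρ : ℝ} (hρ : 1 ≤ ρ) (x : ℕ) :
    ∃ a ∈ support (gammaSeries ρ), a ≤ x ∧
      (x : ℝ) - a + 1 ≤ (ρ + 1) * ((x : ℝ) + 1) ^ (1 - ρ⁻¹) := by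
  have hρ0 : 0 < ρ := by linarith
  set y : ℝ := ((x : ℝ) + 1) ^ ρ⁻¹ with hy
  have hy0 : 0 < y := by positivity
  have hyρ : y ^ ρ = (x : ℝ) + 1 := Real.rpow_inv_rpow (by positivity) hρ0.ne'
  have hyρ1 : y ^ (ρ - 1) = ((x : ℝ) + 1) ^ (1 - ρ⁻¹) := by
    rw [hy, ← Real.rpow_mul (by positivity)]
    congr 1
    field_simp
  -- The witness is m = ⌈y⌉ - 1, the largest natural number with m^ρ < x + 1.
  have hc : 0 < ⌈y⌉₊ := Nat.ceil_pos.2 hy0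
  obtain ⟨m, hm⟩ : ∃ m, ⌈y⌉₊ = m + 1 := ⟨⌈y⌉₊ - 1, by omega⟩
  have h1 : (m : ℝ) < y := Nat.lt_ceil.1 (by omega)
  have h2 : y ≤ m + 1 := by have := Nat.le_ceil y; rw [hm] at this; exact_mod_cast this
  have h3 : (m : ℝ) ^ ρ < x + 1 := by
    rw [← hyρ]
    exact Real.rpow_lt_rpow (by positivity) h1 hρ0
  refine ⟨⌊(m : ℝ) ^ ρ⌋₊, by rw [support_gammaSeries]; exact ⟨m, rfl⟩, ?_, ?_⟩
  · exact Nat.lt_succ_iff.1 ((Nat.floor_lt (by positivity)).2 (by exact_mod_cast h3))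
  · have h4 := Nat.lt_floor_add_one ((m : ℝ) ^ ρ)
    have h5 := rpow_sub_rpow_le hρ hy0 (Nat.cast_nonneg m)
    have h6 : (0 : ℝ) ≤ ρ * y ^ (ρ - 1) := by positivity
    have h7 : ρ * y ^ (ρ - 1) * (y - m) ≤ ρ * y ^ (ρ - 1) :=
      mul_le_of_le_one_right h6 (by linarith)
    have h8 : (1 : ℝ) ≤ y ^ (ρ - 1) := by
      rw [hyρ1]
      exact Real.one_le_rpow (by linarith [(Nat.cast_nonneg x : (0 : ℝ) ≤ x)])
        (by linarith [inv_le_one_of_one_le₀ hρ])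
    rw [← hyρ1]
    linarith

/-- Greedy approximation: subtract from x a nearby element of S(f), then approximate the remainder,
so each factor f raises the error to the power e. Measuring the error as x - a + 1 lets it be fed
directly into the next round. -/
theorem exists_mem_support_pow_near {f : PowerSeries ℤ} (hf : NonnegCoeff f) {K e : ℝ} (hK : 0 < K)
    (h : ∀ x : ℕ, ∃ a ∈ support f, a ≤ x ∧ (x : ℝ) - a + 1 ≤ K * ((x : ℝ) + 1) ^ e)
    (he : 0 ≤ e) (A : ℕ) : ∃ K' : ℝ, 0 < K' ∧ ∀ x : ℕ, ∃ a ∈ support (f ^ A), a ≤ x ∧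
      (x : ℝ) - a + 1 ≤ K' * ((x : ℝ) + 1) ^ (e ^ A) := by
  induction A with
  | zero =>
    refine ⟨1, one_pos, fun x => ⟨0, ?_, Nat.zero_le _, by simp⟩⟩
    simp [support]
  | succ A ih =>
    obtain ⟨K', hK', ih⟩ := ih
    refine ⟨K' * K ^ (e ^ A), by positivity, fun x => ?_⟩
    obtain ⟨a, ha, hax, hxa⟩ := h x
    obtain ⟨b, hb, hbx, hxb⟩ := ih (x - a)
    refine ⟨b + a, ?_, by omega, ?_⟩
    · rw [pow_succ]
      exact add_mem_support_mul (hf.pow A) hf hb ha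
    · rw [Nat.cast_sub hax] at hxb
      have h0 : (0 : ℝ) ≤ (x : ℝ) - a + 1 := by
        have : (a : ℝ) ≤ x := by exact_mod_cast hax
        linarith
      calc (x : ℝ) - (b + a : ℕ) + 1 = (x : ℝ) - a - b + 1 := by push_cast; ring
        _ ≤ K' * ((x : ℝ) - a + 1) ^ (e ^ A) := hxb
        _ ≤ K' * (K * ((x : ℝ) + 1) ^ e) ^ (e ^ A) := by gcongr
        _ = K' * K ^ (e ^ A) * ((x : ℝ) + 1) ^ (e ^ (A + 1)) := by
          rw [Real.mul_rpow hK.le (by positivity), ← Real.rpow_mul (by positivity), pow_succ,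
            mul_comm e, mul_assoc]

end BetaSeries

/-! ### A Liouville-type lower bound from the norm -/

namespace BetaSeries

-- The norm of a nonzero algebraic integer is a nonzero integer. Every embedding of ℚ(β) other than
-- the identity sends β into the closed unit disc, so its factor in the norm is at most B; d counts
-- these embeddings.
open Polynomial in
theorem exists_one_le_abs_aeval_mul_pow {β : ℝ} (hint : IsIntegral ℤ β)
    (hconj : ∀ z : ℂ, IsConjRoot ℚ (β : ℂ) z → z ≠ (β : ℂ) → ‖z‖ ≤ 1) :
    ∃ d : ℕ, ∀ (p : ℤ[X]) (B : ℝ), 0 ≤ B → (∀ z : ℂ, ‖z‖ ≤ 1 → ‖aeval z p‖ ≤ B) →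
      aeval β p ≠ 0 → 1 ≤ |aeval β p| * B ^ d := by
  classical
  have hintQ : IsIntegral ℚ β := hint.tower_top
  set K := IntermediateField.adjoin ℚ ({β} : Set ℝ) with hK
  have : FiniteDimensional ℚ K := IntermediateField.adjoin.finiteDimensional hintQ
  set b : K := IntermediateField.AdjoinSimple.gen ℚ β with hb
  have hbβ : ((b : K) : ℝ) = β := IntermediateField.AdjoinSimple.coe_gen ℚ β
  set σ₀ : K →ₐ[ℚ] ℂ := (Complex.ofRealAm.restrictScalars ℚ).comp K.val with hσ₀
  have hσ₀b : σ₀ b = (β : ℂ) := congrArg Complex.ofReal hbβ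
  have hbint : IsIntegral ℤ b := by
    rw [← hbβ] at hint
    exact (isIntegral_algHom_iff (K.val.restrictScalars ℤ) K.val.injective).1 hint
  have hσ : ∀ σ : K →ₐ[ℚ] ℂ, σ ≠ σ₀ → ‖σ b‖ ≤ 1 := by
    intro σ hne
    refine hconj _ ?_ fun h => hne ?_
    · rw [isConjRoot_def, ← hσ₀b, minpoly.algHom_eq _ σ₀.injective, minpoly.algHom_eq _ σ.injective]
    · refine IntermediateField.algHom_ext_of_eq_adjoin (F := ℚ) hK ?_
      rintro x hx
      obtain rfl : x = β := hx
      exact h.trans hσ₀b.symm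
  refine ⟨(Finset.univ.erase σ₀).card, fun p B hB hp hne => ?_⟩
  set α : K := aeval b p with hα
  have hσα : ∀ σ : K →ₐ[ℚ] ℂ, σ α = aeval (σ b) p := fun σ =>
    (aeval_algHom_apply (σ.restrictScalars ℤ) b p).symm
  have hαβ : ((α : K) : ℝ) = aeval β p := by
    rw [← hbβ]
    exact (aeval_algHom_apply (K.val.restrictScalars ℤ) b p).symm
  have hα0 : α ≠ 0 := by
    rintro h
    exact hne (by rw [← hαβ, h]; simp)
  have hαint : IsIntegral ℤ α := by
    rw [hα]
    exact adjoin_le_integralClosure hbint (aeval_mem_adjoin_singleton ℤ b)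
  obtain ⟨m, hm⟩ := IsIntegrallyClosed.isIntegral_iff.1 (Algebra.isIntegral_norm ℚ hαint)
  have hm0 : m ≠ 0 := by
    rintro rfl
    rw [map_zero] at hm
    exact hα0 (Algebra.norm_eq_zero_iff.1 hm.symm)
  have hprod : (m : ℂ) = ∏ σ : K →ₐ[ℚ] ℂ, σ α := by
    rw [← Algebra.norm_eq_prod_embeddings ℚ ℂ α, ← hm]
    simp
  have h1 : 1 ≤ ‖(m : ℂ)‖ := by
    rw [Complex.norm_intCast]
    exact_mod_cast Int.one_le_abs hm0
  rw [hprod, norm_prod, ← Finset.mul_prod_erase _ _ (Finset.mem_univ σ₀)] at h1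
  have h2 : ‖σ₀ α‖ = |aeval β p| := by
    rw [← hαβ, ← Real.norm_eq_abs, ← Complex.norm_real]
    rfl
  rw [h2] at h1
  refine h1.trans (mul_le_mul_of_nonneg_left ?_ (abs_nonneg _))
  refine (Finset.prod_le_prod (fun _ _ => norm_nonneg _) (g := fun _ => B) fun σ h => ?_).trans
    (by simp)
  rw [hσα]
  exact hp _ (hσ σ (Finset.ne_of_mem_erase h))

end BetaSeries

/-! ### The recurrence y (R+1) = β y R + u (R+1), and counting in gaps -/

namespace BetaSeries

section Recurrence

variable {β c : ℝ} {u y r : ℕ → ℝ}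

theorem recurrence_eq_pow_mul (hy : ∀ R, y (R + 1) = β * y R + u (R + 1)) (R M : ℕ)
    (h : ∀ n, R < n → n ≤ R + M → u n = 0) : y (R + M) = β ^ M * y R := by
  induction M with
  | zero => simp
  | succ M ih =>
    rw [← add_assoc, hy, ih fun n h1 h2 => h n h1 (by omega), h (R + M + 1) (by omega) (by omega),
      pow_succ]
    ring

/-- Without a nonzero u, y would be multiplied by β^M, from at least 1/P to beyond P. -/
theorem exists_ne_zero_of_recurrence {P : ℝ} {N M R : ℕ}
    (hy : ∀ R, y (R + 1) = β * y R + u (R + 1)) (hβ : 0 < β)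
    (hupper : ∀ R ≤ N, |y R| ≤ P) (hlower : ∀ R ≤ N, y R ≠ 0 → 1 ≤ |y R| * P)
    (hM : P * P < β ^ M) (hR : R + M ≤ N) (hne : y R ≠ 0) :
    ∃ n, R < n ∧ n ≤ R + M ∧ u n ≠ 0 := by
  by_contra! h
  have h1 := recurrence_eq_pow_mul hy R M h
  have h2 := hupper _ hR
  have h3 := hlower R (by omega) hne
  have hP : 0 ≤ P := (abs_nonneg _).trans h2
  rw [h1, abs_mul, abs_of_pos (by positivity)] at h2
  have h4 : β ^ M ≤ β ^ M * (|y R| * P) := le_mul_of_one_le_right (by positivity) h3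
  have h5 : β ^ M * |y R| * P ≤ P * P := mul_le_mul_of_nonneg_right h2 hP
  rw [← mul_assoc] at h4
  linarith

theorem recurrence_growth (hy : ∀ R, y (R + 1) = β * y R + u (R + 1)) (hβ : 0 < β) (a j : ℕ)
    (hu : ∀ n, a < n → n ≤ a + j → u n = c * r n) (hr : ∀ n, 0 ≤ r n) {z : ℝ}
    (hya : y a = c * z) : ∃ z', β ^ j * z ≤ z' ∧ y (a + j) = c * z' := by
  induction j with
  | zero => exact ⟨z, by simp, hya⟩
  | succ j ih =>
    obtain ⟨z', hz', h⟩ := ih fun n h1 h2 => hu n h1 (by omega)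
    refine ⟨β * z' + r (a + j + 1), ?_, ?_⟩
    · have := mul_le_mul_of_nonneg_left hz' hβ.le
      rw [pow_succ]
      linarith [hr (a + j + 1)]
    · rw [← add_assoc, hy, h, hu _ (by omega) (by omega)]
      ring

/-- Starting from y R = 0, all contributions have the sign of c, so nothing cancels the one made at
v; after M further steps it exceeds the bound P. -/
theorem recurrence_ne_zero {P : ℝ} {M R v R' : ℕ}
    (hy : ∀ R, y (R + 1) = β * y R + u (R + 1)) (hβ : 1 < β) (hRv : R < v) (hv : v + M ≤ R')
    (hu : ∀ n, R < n → n ≤ R' → u n = c * r n) (hr : ∀ n, 0 ≤ r n) (hrv : 1 ≤ r v)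
    (hupper : |y R'| ≤ P) (hP : P < |c| * β ^ M) : y R ≠ 0 := by
  intro h0
  have hβ0 : 0 < β := by linarith
  obtain ⟨j, rfl⟩ : ∃ j, v = R + j + 1 := ⟨v - R - 1, by omega⟩
  obtain ⟨i, rfl⟩ : ∃ i, R' = R + j + 1 + i := ⟨R' - (R + j + 1), by omega⟩
  obtain ⟨z, hz, h1⟩ := recurrence_growth hy hβ0 R j (fun n h1 h2 => hu n h1 (by omega)) hr
    (z := 0) (by simpa using h0)
  have h2 : y (R + j + 1) = c * (β * z + r (R + j + 1)) := by
    rw [hy, h1, hu _ (by omega) (by omega)]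
    ring
  obtain ⟨z', hz', h3⟩ := recurrence_growth hy hβ0 (R + j + 1) i
    (fun n h1 h2 => hu n (by omega) h2) hr h2
  have hz0 : 0 ≤ β * z := mul_nonneg hβ0.le (by simpa using hz)
  have h4 : β ^ M ≤ z' := by
    calc β ^ M ≤ β ^ i := pow_le_pow_right₀ hβ.le (by omega)
      _ ≤ β ^ i * (β * z + r (R + j + 1)) := le_mul_of_one_le_right (by positivity) (by linarith)
      _ ≤ z' := hz'
  rw [h3, abs_mul, abs_of_nonneg ((by positivity : 0 ≤ β ^ M).trans h4)] at hupper
  have := mul_le_mul_of_nonneg_left h4 (abs_nonneg c)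
  linarith

end Recurrence

theorem exists_consecutive_mem {W : Set ℕ} [DecidablePred (· ∈ W)] {N h R : ℕ}
    (hW : ∀ x ≤ 2 * N, ∃ w ∈ W, w ≤ x ∧ x < w + h) (hh : h ≤ N) (hR : R < N) :
    ∃ w', Nat.findGreatest (· ∈ W) R ∈ W ∧ w' ∈ W ∧ Nat.findGreatest (· ∈ W) R ≤ R ∧ R < w' ∧
      R < Nat.findGreatest (· ∈ W) R + h ∧ w' ≤ R + h ∧
      ∀ n, Nat.findGreatest (· ∈ W) R < n → n < w' → n ∉ W := by
  obtain ⟨a, ha, haR, hRa⟩ := hW R (by omega)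
  obtain ⟨b, hb, hbR, hRb⟩ := hW (R + h) (by omega)
  have hex : ∃ w', w' ∈ W ∧ R < w' := ⟨b, hb, by omega⟩
  have hle := Nat.le_findGreatest (P := (· ∈ W)) haR ha
  refine ⟨Nat.find hex, Nat.findGreatest_spec (P := (· ∈ W)) haR ha, (Nat.find_spec hex).1,
    Nat.findGreatest_le R, (Nat.find_spec hex).2, by omega,
    (Nat.find_min' hex ⟨hb, by omega⟩).trans hbR, fun n h1 h2 hn => ?_⟩
  rcases le_or_gt n R with h3 | h3
  · exact Nat.findGreatest_is_greatest h1 h3 hn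
  · exact Nat.find_min hex h2 ⟨hn, h3⟩

/-- The integers below N are of three kinds: within h of E, in a W-gap shorter than l, or in a good
gap. The map φ shrinks the distance to the left end of the gap by the factor C. It is at most
C-to-one and moves good points to the start of their gap, where `hgap` supplies an element of U
within M. -/
theorem le_card_of_consecutive_gaps {E W U : Set ℕ} {N h l M C : ℕ} (hC : 0 < C)
    (hW : ∀ x ≤ 2 * N, ∃ w ∈ W, w ≤ x ∧ x < w + h) (hh : h ≤ N) (hM : M ≤ N)
    (hgap : ∀ w w' R, w ∈ W → w' ∈ W → w' ≤ 2 * N → (∀ n, w < n → n < w' → n ∉ W ∧ n ∉ E) →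
      w + l ≤ w' → w ≤ R → C * (R - w) ≤ w' - w → ∃ n ∈ U, R < n ∧ n ≤ R + M) :
    N ≤ (below E (2 * N + 1)).card * (2 * h) + (below W (2 * N + 1)).card * l +
      C * ((below U (2 * N + 1)).card * M) := by
  classical
  set p : ℕ → ℕ := Nat.findGreatest (· ∈ W) with hp
  set φ : ℕ → ℕ := fun R => p R + (R - p R) / C with hφ
  set B₁ := (below E (2 * N + 1)).biUnion fun e => Finset.Ico (e + 1 - h) (e + h) with hB₁
  set B₂ := (below W (2 * N + 1)).biUnion fun w => Finset.Ico w (w + l) with hB₂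
  set T := ((Finset.range N).filter fun R => R ∉ B₁).filter fun R => R ∉ B₂ with hT
  have c₁ : B₁.card ≤ (below E (2 * N + 1)).card * (2 * h) :=
    Finset.card_biUnion_le_card_mul _ _ _ fun e _ => by rw [Nat.card_Ico]; omega
  have c₂ : B₂.card ≤ (below W (2 * N + 1)).card * l :=
    Finset.card_biUnion_le_card_mul _ _ _ fun e _ => by rw [Nat.card_Ico]; omega
  have hpφ : ∀ R < N, p R ≤ φ R ∧ φ R ≤ R ∧ p (φ R) = p R := by
    intro R hR
    obtain ⟨w', h1, h2, h3, h4, h5, h6, h7⟩ := exists_consecutive_mem hW hh hR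
    have h8 : p R ≤ φ R := Nat.le_add_right _ _
    have h9 : φ R ≤ R := by
      have := Nat.div_le_self (R - p R) C
      simp only [hφ, hp] at *
      omega
    refine ⟨h8, h9, ?_⟩
    refine Nat.findGreatest_eq_iff.2 ⟨h8, fun _ => h1, fun n hn hn2 => h7 n hn ?_⟩
    exact lt_of_le_of_lt (hn2.trans h9) h4
  have c₃ : T.card ≤ C * (T.image φ).card := by
    refine Finset.card_le_mul_card_image T C fun b hb => ?_
    -- Since φ R stays in the gap of R, its value determines p R and the quotient (R - p R) / C,
    -- leaving C choices for the remainder.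
    have hsub : (T.filter fun R => φ R = b) ⊆
        Finset.Ico (p b + C * (b - p b)) (p b + C * (b - p b) + C) := by
      intro R hR
      obtain ⟨hRT, rfl⟩ := Finset.mem_filter.1 hR
      have hRN : R < N := by simp [hT] at hRT; exact hRT.1.1
      obtain ⟨h1, h2, h3⟩ := hpφ R hRN
      have h4 : φ R - p R = (R - p R) / C := by simp [hφ]
      rw [h3, h4]
      have h5 := Nat.div_add_mod (R - p R) C
      have h6 := Nat.mod_lt (R - p R) hC
      rw [Finset.mem_Ico]
      omega
    refine (Finset.card_le_card hsub).trans ?_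
    simp
  have c₄ : (T.image φ).card ≤ (below U (2 * N + 1)).card * M := by
    refine (Finset.card_le_card (t := (below U (2 * N + 1)).biUnion fun n => Finset.Ico (n - M) n)
      fun b hb => ?_).trans
      (Finset.card_biUnion_le_card_mul _ _ _ fun e _ => by rw [Nat.card_Ico]; omega)
    obtain ⟨R, hRT, rfl⟩ := Finset.mem_image.1 hb
    simp only [hT, Finset.mem_filter, Finset.mem_range] at hRT
    obtain ⟨⟨hRN, hR₁⟩, hR₂⟩ := hRT
    obtain ⟨w', h1, h2, h3, h4, h5, h6, h7⟩ := exists_consecutive_mem hW hh hRN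
    have h8 := hpφ R hRN
    have h9 : p R + l ≤ w' := by
      by_contra hlt
      refine hR₂ (Finset.mem_biUnion.2 ⟨p R, mem_below.2 ⟨?_, h1⟩, Finset.mem_Ico.2 ⟨h3, ?_⟩⟩)
      · simp only [hp]; omega
      · omega
    have h10 : C * (φ R - p R) ≤ w' - p R := by
      have h4' : φ R - p R = (R - p R) / C := by simp [hφ]
      rw [h4']
      have := Nat.mul_div_le (R - p R) C
      omega
    obtain ⟨n, hn, hn1, hn2⟩ := hgap (p R) w' (φ R) h1 h2 (by omega)
      (fun n hn1 hn2 => ⟨h7 n hn1 hn2, fun hnE => hR₁ (Finset.mem_biUnion.2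
        ⟨n, mem_below.2 ⟨by omega, hnE⟩, Finset.mem_Ico.2
          ⟨by simp only [hp] at *; omega, by simp only [hp] at *; omega⟩⟩)⟩) h9 h8.1 h10
    exact Finset.mem_biUnion.2 ⟨n, mem_below.2 ⟨by omega, hn⟩, Finset.mem_Ico.2 ⟨by omega, hn1⟩⟩
  have c₅ : N ≤ B₁.card + B₂.card + T.card := by
    have hsub : Finset.range N ⊆ B₁ ∪ B₂ ∪ T := by
      intro R hR
      simp only [hT, Finset.mem_union, Finset.mem_filter]
      tauto
    have h1 := Finset.card_le_card hsub
    have h2 := Finset.card_union_le (B₁ ∪ B₂) T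
    have h3 := Finset.card_union_le B₁ B₂
    rw [Finset.card_range] at h1
    omega
  have c₆ := Nat.mul_le_mul_left C c₄
  omega

end BetaSeries

/-! ### Rescaled partial sums of the relation and their size at β and its conjugates -/

namespace BetaSeries

open Polynomial

/-- The part of `∑ c n X ^ (-n)` up to `X ^ (-R)`, multiplied by `X ^ R`. -/
noncomputable def head (c : ℕ → ℤ[X]) (R : ℕ) : ℤ[X] :=
  ∑ n ∈ Finset.range (R + 1), c n * X ^ (R - n)

theorem head_succ (c : ℕ → ℤ[X]) (R : ℕ) : head c (R + 1) = X * head c R + c (R + 1) := by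
  rw [head, Finset.sum_range_succ, head, Finset.mul_sum]
  congr 1
  · refine Finset.sum_congr rfl fun n hn => ?_
    rw [show R + 1 - n = R - n + 1 by have := Finset.mem_range.1 hn; omega, pow_succ]
    ring
  · simp

theorem norm_aeval_head_le {c : ℕ → ℤ[X]} {C : ℝ} {e : ℕ} (hC : 0 ≤ C) {z : ℂ} (hz : ‖z‖ ≤ 1)
    (hc : ∀ n : ℕ, ‖aeval z (c n)‖ ≤ C * ((n : ℝ) + 1) ^ e) (R : ℕ) :
    ‖aeval z (head c R)‖ ≤ C * ((R : ℝ) + 1) ^ (e + 1) := by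
  rw [head, map_sum]
  calc ‖∑ n ∈ Finset.range (R + 1), aeval z (c n * X ^ (R - n))‖
      ≤ ∑ n ∈ Finset.range (R + 1), ‖aeval z (c n * X ^ (R - n))‖ := norm_sum_le _ _
    _ ≤ ∑ n ∈ Finset.range (R + 1), C * ((R : ℝ) + 1) ^ e := by
        refine Finset.sum_le_sum fun n hn => ?_
        have h1 : (n : ℝ) ≤ R := by exact_mod_cast Nat.lt_succ_iff.1 (Finset.mem_range.1 hn)
        rw [map_mul, map_pow, aeval_X, norm_mul, norm_pow]
        refine (mul_le_of_le_one_right (norm_nonneg _) (pow_le_one₀ (norm_nonneg _) hz)).trans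
          ((hc n).trans ?_)
        gcongr
    _ = C * ((R : ℝ) + 1) ^ (e + 1) := by
        rw [Finset.sum_const, Finset.card_range, nsmul_eq_mul]
        push_cast
        ring

/-- Because the full sum is zero, the head equals minus β^R times the tail, and the tail is a
convergent series of size β^(-R) up to a polynomial factor. -/
theorem abs_aeval_head_le {c : ℕ → ℤ[X]} {C β : ℝ} {e : ℕ} (hC : 0 ≤ C) (hβ : 1 < β)
    (hc : ∀ n : ℕ, |aeval β (c n)| ≤ C * ((n : ℝ) + 1) ^ e)
    (hsum : HasSum (fun n => aeval β (c n) * β⁻¹ ^ n) 0) :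
    ∃ C' : ℝ, 0 ≤ C' ∧ ∀ R : ℕ, |aeval β (head c R)| ≤ C' * ((R : ℝ) + 1) ^ e := by
  have hβ0 : 0 < β := by linarith
  have hx0 : 0 < β⁻¹ := inv_pos.2 hβ0
  have hx1 : β⁻¹ < 1 := inv_lt_one_of_one_lt₀ hβ
  have hs := summable_add_one_pow_mul_geometric e hx0 hx1
  refine ⟨C * 2 ^ e * ∑' n : ℕ, ((n : ℝ) + 1) ^ e * β⁻¹ ^ n, ?_, fun R => ?_⟩
  · exact mul_nonneg (by positivity) (tsum_nonneg fun n => by positivity)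
  have hhead : aeval β (head c R) =
      β ^ R * ∑ n ∈ Finset.range (R + 1), aeval β (c n) * β⁻¹ ^ n := by
    rw [head, map_sum, Finset.mul_sum]
    refine Finset.sum_congr rfl fun n hn => ?_
    have h1 : n ≤ R := Nat.lt_succ_iff.1 (Finset.mem_range.1 hn)
    rw [map_mul, map_pow, aeval_X, inv_pow, pow_sub₀ _ hβ0.ne' h1]
    ring
  have htail : ∑ n ∈ Finset.range (R + 1), aeval β (c n) * β⁻¹ ^ n =
      -∑' n : ℕ, aeval β (c (n + (R + 1))) * β⁻¹ ^ (n + (R + 1)) := by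
    have := hsum.summable.sum_add_tsum_nat_add (R + 1)
    rw [hsum.tsum_eq] at this
    linarith
  have hb : ∀ n : ℕ, ‖aeval β (c (n + (R + 1))) * β⁻¹ ^ (n + (R + 1))‖ ≤
      C * 2 ^ e * ((R : ℝ) + 1) ^ e * β⁻¹ ^ R * (((n : ℝ) + 1) ^ e * β⁻¹ ^ n) := by
    intro n
    rw [norm_mul, Real.norm_eq_abs, Real.norm_of_nonneg (by positivity), pow_add, pow_succ]
    have h1 : |aeval β (c (n + (R + 1)))| * (β⁻¹ ^ n * (β⁻¹ ^ R * β⁻¹)) ≤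
        (C * (((n + (R + 1) : ℕ) : ℝ) + 1) ^ e * β⁻¹) * (β⁻¹ ^ n * β⁻¹ ^ R) := by
      have := mul_le_mul_of_nonneg_right (hc (n + (R + 1)))
        (by positivity : 0 ≤ β⁻¹ * (β⁻¹ ^ n * β⁻¹ ^ R))
      linarith
    -- The inequality n + R + 2 ≤ 2(n + 1)(R + 1) separates the variables.
    have h2 : (((n + (R + 1) : ℕ) : ℝ) + 1) ^ e * β⁻¹ ≤ 2 ^ e * (((n : ℝ) + 1) ^ e * ((R : ℝ) + 1) ^ e) := by
      refine (mul_le_of_le_one_right (by positivity) hx1.le).trans ?_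
      rw [← mul_pow, ← mul_pow]
      refine pow_le_pow_left₀ (by positivity) ?_ e
      push_cast
      nlinarith [mul_nonneg (Nat.cast_nonneg (α := ℝ) n) (Nat.cast_nonneg (α := ℝ) R),
        Nat.cast_nonneg (α := ℝ) n, Nat.cast_nonneg (α := ℝ) R]
    calc _ ≤ _ := h1
      _ = C * ((((n + (R + 1) : ℕ) : ℝ) + 1) ^ e * β⁻¹) * (β⁻¹ ^ n * β⁻¹ ^ R) := by ring
      _ ≤ C * (2 ^ e * (((n : ℝ) + 1) ^ e * ((R : ℝ) + 1) ^ e)) * (β⁻¹ ^ n * β⁻¹ ^ R) := by gcongr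
      _ = _ := by ring
  have hfin := tsum_of_norm_bounded (hs.hasSum.mul_left (C * 2 ^ e * ((R : ℝ) + 1) ^ e * β⁻¹ ^ R)) hb
  rw [hhead, htail, mul_neg, abs_neg, abs_mul, abs_of_pos (by positivity)]
  calc _ ≤ β ^ R * (C * 2 ^ e * ((R : ℝ) + 1) ^ e * β⁻¹ ^ R * ∑' n : ℕ, ((n : ℝ) + 1) ^ e * β⁻¹ ^ n) :=
        mul_le_mul_of_nonneg_left hfin (by positivity)
    _ = (β ^ R * β⁻¹ ^ R) * (C * 2 ^ e * (∑' n : ℕ, ((n : ℝ) + 1) ^ e * β⁻¹ ^ n) * ((R : ℝ) + 1) ^ e) := by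
        ring
    _ = _ := by rw [← mul_pow, mul_inv_cancel₀ hβ0.ne', one_pow, one_mul]

theorem exists_norm_aeval_le (p : ℤ[X]) (r : ℝ) :
    ∃ B : ℝ, 0 ≤ B ∧ ∀ z : ℂ, ‖z‖ ≤ r → ‖aeval z p‖ ≤ B := by
  obtain ⟨B, hB⟩ := (isCompact_closedBall (0 : ℂ) r).exists_bound_of_continuousOn
    (f := fun z => aeval z p) (by fun_prop)
  exact ⟨max B 0, le_max_right _ _, fun z hz => (hB z (by simpa using hz)).trans (le_max_left _ _)⟩

theorem norm_aeval_ofReal (p : ℤ[X]) (β : ℝ) : ‖aeval (β : ℂ) p‖ = |aeval β p| := by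
  rw [← Real.norm_eq_abs, ← Complex.norm_real, ← Complex.coe_algebraMap, aeval_algebraMap_apply]

/-- The coefficients of `∑ k ∈ s, q k * f ^ k.1 * g ^ k.2`. -/
noncomputable def relCoeff (s : Finset (ℕ × ℕ)) (q : ℕ × ℕ → ℤ[X]) (f g : PowerSeries ℤ) (n : ℕ) :
    ℤ[X] :=
  ∑ k ∈ s, q k * C (PowerSeries.coeff n (f ^ k.1 * g ^ k.2))

theorem aeval_relCoeff {S : Type*} [CommRing S] (s : Finset (ℕ × ℕ)) (q : ℕ × ℕ → ℤ[X])
    (f g : PowerSeries ℤ) (n : ℕ) (z : S) : aeval z (relCoeff s q f g n) =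
      ∑ k ∈ s, aeval z (q k) * ((PowerSeries.coeff n (f ^ k.1 * g ^ k.2) : ℤ) : S) := by
  simp [relCoeff, map_sum]

theorem exists_norm_aeval_relCoeff_le (s : Finset (ℕ × ℕ)) (q : ℕ × ℕ → ℤ[X])
    {f g : PowerSeries ℤ} (hf : PolyBounded f) (hg : PolyBounded g) (r : ℝ) :
    ∃ (B : ℝ) (e : ℕ), 0 ≤ B ∧ ∀ z : ℂ, ‖z‖ ≤ r → ∀ n : ℕ,
      ‖aeval z (relCoeff s q f g n)‖ ≤ B * ((n : ℝ) + 1) ^ e := by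
  simp only [aeval_relCoeff]
  induction s using Finset.induction_on with
  | empty => exact ⟨0, 0, le_rfl, fun z _ n => by simp⟩
  | insert k s hk ih =>
    obtain ⟨B, e, hB, ih⟩ := ih
    obtain ⟨B', hB', hq⟩ := exists_norm_aeval_le (q k) r
    obtain ⟨D, i, hD, hfg⟩ := (hf.pow k.1).mul (hg.pow k.2)
    refine ⟨B' * D + B, max i e, by positivity, fun z hz n => ?_⟩
    rw [Finset.sum_insert hk, add_mul]
    have h1 : (1 : ℝ) ≤ (n : ℝ) + 1 := by linarith [Nat.cast_nonneg (α := ℝ) n]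
    refine (norm_add_le _ _).trans (add_le_add ?_ ((ih z hz n).trans ?_))
    · rw [norm_mul, Complex.norm_intCast, mul_assoc]
      refine mul_le_mul (hq z hz) ((hfg n).trans ?_) (abs_nonneg _) hB'
      exact mul_le_mul_of_nonneg_left (pow_le_pow_right₀ h1 (le_max_left _ _)) hD
    · exact mul_le_mul_of_nonneg_left (pow_le_pow_right₀ h1 (le_max_right _ _)) hB

theorem hasSum_relCoeff (s : Finset (ℕ × ℕ)) (q : ℕ × ℕ → ℤ[X]) {f g : PowerSeries ℤ}
    (hf : PolyBounded f) (hg : PolyBounded g) {β x : ℝ} (hx0 : 0 < x) (hx1 : x < 1) :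
    HasSum (fun n => aeval β (relCoeff s q f g n) * x ^ n)
      (∑ k ∈ s, aeval β (q k) * (value f x ^ k.1 * value g x ^ k.2)) := by
  simp only [aeval_relCoeff, Finset.sum_mul]
  refine hasSum_sum fun k _ => ?_
  rw [← value_pow hf hx0 hx1, ← value_pow hg hx0 hx1, ← value_mul (hf.pow _) (hg.pow _) hx0 hx1]
  simp only [mul_assoc]
  exact (((hf.pow _).mul (hg.pow _)).summable hx0 hx1).of_norm.hasSum.mul_left _

theorem exists_bounds_head_relCoeff {β : ℝ} (hβ : 1 < β) (hint : IsIntegral ℤ β)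
    (hconj : ∀ z : ℂ, IsConjRoot ℚ (β : ℂ) z → z ≠ (β : ℂ) → ‖z‖ ≤ 1)
    (s : Finset (ℕ × ℕ)) (q : ℕ × ℕ → ℤ[X]) {f g : PowerSeries ℤ}
    (hf : PolyBounded f) (hg : PolyBounded g)
    (hrel : ∑ k ∈ s, aeval β (q k) * (value f β⁻¹ ^ k.1 * value g β⁻¹ ^ k.2) = 0) :
    ∃ (B : ℝ) (e : ℕ), 0 ≤ B ∧ ∀ R : ℕ,
      |aeval β (head (relCoeff s q f g) R)| ≤ B * ((R : ℝ) + 1) ^ e ∧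
      (aeval β (head (relCoeff s q f g) R) ≠ 0 →
        1 ≤ |aeval β (head (relCoeff s q f g) R)| * (B * ((R : ℝ) + 1) ^ e)) := by
  have hβ0 : 0 < β := by linarith
  -- A disc of radius β contains both β and the closed unit disc, so one bound serves the tail
  -- estimate and the conjugates.
  obtain ⟨B, e, hB, hu⟩ := exists_norm_aeval_relCoeff_le s q hf hg β
  have hsum := hasSum_relCoeff s q hf hg (β := β) (inv_pos.2 hβ0) (inv_lt_one_of_one_lt₀ hβ)
  rw [hrel] at hsum
  obtain ⟨B₁, hB₁, h₁⟩ := abs_aeval_head_le hB hβ (e := e) (fun n => by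
    rw [← norm_aeval_ofReal]
    exact hu _ (by rw [Complex.norm_real, Real.norm_of_nonneg hβ0.le]) n) hsum
  obtain ⟨d, hd⟩ := exists_one_le_abs_aeval_mul_pow hint hconj
  refine ⟨max B₁ (B ^ d), max e ((e + 1) * d), le_max_of_le_left hB₁, fun R => ?_⟩
  have hR : (1 : ℝ) ≤ (R : ℝ) + 1 := by linarith [Nat.cast_nonneg (α := ℝ) R]
  refine ⟨(h₁ R).trans ?_, fun hne => ?_⟩
  · exact mul_le_mul (le_max_left _ _) (pow_le_pow_right₀ hR (le_max_left _ _)) (by positivity)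
      (le_max_of_le_left hB₁)
  · have h2 := hd (head (relCoeff s q f g) R) (B * ((R : ℝ) + 1) ^ (e + 1)) (by positivity)
      (fun z hz => norm_aeval_head_le hB hz (hu z (hz.trans hβ.le)) R) hne
    refine h2.trans (mul_le_mul_of_nonneg_left ?_ (abs_nonneg _))
    rw [mul_pow, ← pow_mul]
    exact mul_le_mul (le_max_right _ _) (pow_le_pow_right₀ hR (le_max_right _ _)) (by positivity)
      (le_max_of_le_left hB₁)

end BetaSeries

/-! ### Behaviour in a clean gap, and sizes of the exponent sets -/

namespace BetaSeries

open Polynomial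

/-- The exponents of the terms of degree less than `A` in `f`. -/
def lowSupport (s : Finset (ℕ × ℕ)) (f g : PowerSeries ℤ) (A : ℕ) : Set ℕ :=
  {n | ∃ k ∈ s, k.1 < A ∧ n ∈ support (f ^ k.1 * g ^ k.2)}

/-- The exponents occurring in `f ^ A * g ^ j` for some `j < D`. -/
def midSupport (f g : PowerSeries ℤ) (A D : ℕ) : Set ℕ :=
  {n | ∃ j < D, n ∈ support (f ^ A * g ^ j)}

/-- The exponents of all terms. -/
def fullSupport (s : Finset (ℕ × ℕ)) (f g : PowerSeries ℤ) : Set ℕ :=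
  {n | ∃ k ∈ s, n ∈ support (f ^ k.1 * g ^ k.2)}

theorem exists_mem_fullSupport_of_gap {β : ℝ} (hβ : 1 < β) {s : Finset (ℕ × ℕ)}
    {q : ℕ × ℕ → ℤ[X]} {f g : PowerSeries ℤ} (hf : NonnegCoeff f) (hg : NonnegCoeff g) {A D : ℕ}
    (hs : ∀ k ∈ s, k.1 < A ∨ k.1 = A ∧ k.2 < D ∨ k = (A, D)) (htop : (A, D) ∈ s)
    {N M C : ℕ} {P r₀ : ℝ} (hC : 0 < C)
    (hmeets : ∀ r : ℝ, r₀ ≤ r → ∃ t ∈ support g, r ≤ t ∧ (t : ℝ) ≤ C * r)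
    (hupper : ∀ R ≤ N, |aeval β (head (relCoeff s q f g) R)| ≤ P)
    (hlower : ∀ R ≤ N, aeval β (head (relCoeff s q f g) R) ≠ 0 →
      1 ≤ |aeval β (head (relCoeff s q f g) R)| * P)
    (hP : P * P < β ^ M) (hPc : P < |aeval β (q (A, D))| * β ^ M)
    {l w w' R : ℕ} (hl : 2 * M + 2 ≤ l) (hlr : 2 * C * r₀ ≤ l)
    (hw : w ∈ midSupport f g A D) (hw'N : w' + M ≤ N)
    (hfree : ∀ n, w < n → n < w' → n ∉ midSupport f g A D ∧ n ∉ lowSupport s f g A)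
    (hww' : w + l ≤ w') (hwR : w ≤ R) (hR : (2 * C + 1) * (R - w) ≤ w' - w) :
    ∃ n ∈ fullSupport s f g, R < n ∧ n ≤ R + M := by
  obtain ⟨L, rfl⟩ : ∃ L, w' = w + L := ⟨w' - w, by omega⟩
  obtain ⟨i, rfl⟩ : ∃ i, R = w + i := ⟨R - w, by omega⟩
  simp only [add_tsub_cancel_left] at hR
  have hLl : l ≤ L := by omega
  have hC' : (0 : ℝ) < C := by exact_mod_cast hC
  have hLl' : (l : ℝ) ≤ L := by exact_mod_cast hLl
  -- This choice puts t in [L/(2C), L/2]: beyond the offset i, as (2C + 1)i ≤ L, and leaving at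
  -- least M steps before the gap ends.
  obtain ⟨t, ht, hrt, htr⟩ := hmeets (L / (2 * C)) (by
    rw [le_div_iff₀ (by positivity)]
    linarith)
  have hit : i < t := by
    have h1 : (L : ℝ) ≤ t * (2 * C) := (div_le_iff₀ (by positivity)).1 hrt
    have h2 : L ≤ t * (2 * C) := by exact_mod_cast h1
    by_contra! h3
    have h4 : t * (2 * C) ≤ i * (2 * C) := Nat.mul_le_mul_right _ h3
    have h5 : (2 * C + 1) * i = i * (2 * C) + i := by ring
    have hi : i = 0 := by omega
    subst hi
    simp only [Nat.le_zero] at h3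
    subst h3
    omega
  have htL : 2 * t ≤ L := by
    have : (C : ℝ) * (L / (2 * C)) = L / 2 := by field_simp
    rw [this] at htr
    have h1 : (2 : ℝ) * t ≤ L := by linarith
    exact_mod_cast h1
  set r : ℕ → ℝ := fun n => ((PowerSeries.coeff n (f ^ A * g ^ D) : ℤ) : ℝ) with hr
  have hy : ∀ R, aeval β (head (relCoeff s q f g) (R + 1)) =
      β * aeval β (head (relCoeff s q f g) R) + aeval β (relCoeff s q f g (R + 1)) := fun R => by
    rw [head_succ, map_add, map_mul, aeval_X]
  have hr0 : ∀ n, 0 ≤ r n := fun n => by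
    simp only [hr]
    exact_mod_cast (hf.pow A).mul (hg.pow D) n
  have hu : ∀ n, w + i < n → n ≤ w + L - 1 →
      aeval β (relCoeff s q f g n) = aeval β (q (A, D)) * r n := by
    intro n h1 h2
    obtain ⟨hnW, hnE⟩ := hfree n (by omega) (by omega)
    rw [aeval_relCoeff, Finset.sum_eq_single (A, D)]
    · rintro ⟨k₁, k₂⟩ hk hne
      have h0 : PowerSeries.coeff n (f ^ k₁ * g ^ k₂) = 0 := by
        by_contra hcoeff
        rcases hs _ hk with h | ⟨rfl, h⟩ | h
        · exact hnE ⟨_, hk, h, hcoeff⟩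
        · exact hnW ⟨_, h, hcoeff⟩
        · exact hne h
      simp [h0]
    · exact fun h => (h htop).elim
  have hrv : 1 ≤ r (w + t) := by
    obtain ⟨j, hj, hwj⟩ := hw
    have h1 : w + t ∈ support (f ^ A * g ^ (j + 1)) := by
      rw [pow_succ, ← mul_assoc]
      exact add_mem_support_mul ((hf.pow A).mul (hg.pow j)) hg hwj ht
    -- If j + 1 < D, then w + t would be an element of W strictly inside the gap.
    have h2 : j + 1 = D := by
      by_contra h3
      exact (hfree (w + t) (by omega) (by omega)).1 ⟨j + 1, by omega, h1⟩
    rw [h2] at h1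
    have h3 : 0 < PowerSeries.coeff (w + t) (f ^ A * g ^ D) :=
      lt_of_le_of_ne ((hf.pow A).mul (hg.pow D) _) (Ne.symm h1)
    simp only [hr]
    exact_mod_cast h3
  have hne := recurrence_ne_zero (y := fun R => aeval β (head (relCoeff s q f g) R))
    (u := fun n => aeval β (relCoeff s q f g n)) hy hβ (R := w + i) (v := w + t) (R' := w + L - 1)
    (by omega) (by omega) hu hr0 hrv (hupper _ (by omega)) hPc
  obtain ⟨n, h1, h2, h3⟩ := exists_ne_zero_of_recurrence
    (y := fun R => aeval β (head (relCoeff s q f g) R))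
    (u := fun n => aeval β (relCoeff s q f g n)) hy (by linarith) hupper hlower hP
    (R := w + i) (by omega) hne
  refine ⟨n, ?_, h1, h2⟩
  rw [aeval_relCoeff] at h3
  obtain ⟨k, hk, h4⟩ := Finset.exists_ne_zero_of_sum_ne_zero h3
  exact ⟨k, hk, fun h => h4 (by rw [h]; simp)⟩

section Counting

variable {f g : PowerSeries ℤ} {N : ℕ} {F G : ℝ}

theorem card_below_pow_mul_pow_le_of_le (hF : 1 ≤ F) (hG : 1 ≤ G)
    (hf : ((below (support f) N).card : ℝ) ≤ F) (hg : ((below (support g) N).card : ℝ) ≤ G)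
    {i j A D : ℕ} (hi : i ≤ A) (hj : j ≤ D) :
    ((below (support (f ^ i * g ^ j)) N).card : ℝ) ≤ F ^ A * G ^ D := by
  calc ((below (support (f ^ i * g ^ j)) N).card : ℝ)
      ≤ ((below (support f) N).card : ℝ) ^ i * ((below (support g) N).card : ℝ) ^ j := by
        exact_mod_cast card_below_pow_mul_pow_le f g i j N
    _ ≤ F ^ i * G ^ j := by gcongr
    _ ≤ F ^ A * G ^ D := by gcongr

theorem card_below_le_of_subset {ι : Type*} {S : Set ℕ} (s : Finset ι) (T : ι → Set ℕ) {K : ℝ}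
    (hS : ∀ n ∈ S, ∃ k ∈ s, n ∈ T k) (hT : ∀ k ∈ s, ((below (T k) N).card : ℝ) ≤ K) :
    ((below S N).card : ℝ) ≤ s.card * K := by
  classical
  have h1 : below S N ⊆ s.biUnion fun k => below (T k) N := by
    intro n hn
    obtain ⟨hnN, hn⟩ := mem_below.1 hn
    obtain ⟨k, hk, hnk⟩ := hS n hn
    exact Finset.mem_biUnion.2 ⟨k, hk, mem_below.2 ⟨hnN, hnk⟩⟩
  have h2 : ((below S N).card : ℝ) ≤ ∑ k ∈ s, ((below (T k) N).card : ℝ) := by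
    exact_mod_cast (Finset.card_le_card h1).trans Finset.card_biUnion_le
  refine h2.trans ((Finset.sum_le_sum hT).trans ?_)
  rw [Finset.sum_const, nsmul_eq_mul]

theorem card_below_lowSupport_le (hF : 1 ≤ F) (hG : 1 ≤ G)
    (hf : ((below (support f) N).card : ℝ) ≤ F) (hg : ((below (support g) N).card : ℝ) ≤ G)
    {s : Finset (ℕ × ℕ)} {A D' : ℕ} (hs : ∀ k ∈ s, k.2 ≤ D') :
    ((below (lowSupport s f g A) N).card : ℝ) ≤ s.card * (F ^ (A - 1) * G ^ D') := by
  refine (card_below_le_of_subset (s.filter fun k => k.1 < A)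
    (fun k => support (f ^ k.1 * g ^ k.2)) (K := F ^ (A - 1) * G ^ D') ?_ ?_).trans ?_
  · rintro n ⟨k, hk, hkA, hn⟩
    exact ⟨k, Finset.mem_filter.2 ⟨hk, hkA⟩, hn⟩
  · intro k hk
    obtain ⟨hk, hkA⟩ := Finset.mem_filter.1 hk
    exact card_below_pow_mul_pow_le_of_le hF hG hf hg (by omega) (hs k hk)
  · gcongr
    exact Finset.filter_subset _ _

theorem card_below_midSupport_le (hF : 1 ≤ F) (hG : 1 ≤ G)
    (hf : ((below (support f) N).card : ℝ) ≤ F) (hg : ((below (support g) N).card : ℝ) ≤ G)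
    {A D D' : ℕ} (hD : D ≤ D') :
    ((below (midSupport f g A D) N).card : ℝ) ≤ D * (F ^ A * G ^ D') := by
  have h := card_below_le_of_subset (N := N) (S := midSupport f g A D) (Finset.range D)
    (fun j => support (f ^ A * g ^ j)) (K := F ^ A * G ^ D')
    (fun n ⟨j, hj, hn⟩ => ⟨j, Finset.mem_range.2 hj, hn⟩)
    fun j hj => card_below_pow_mul_pow_le_of_le hF hG hf hg le_rfl
      ((Finset.mem_range.1 hj).le.trans hD)
  rwa [Finset.card_range] at h

theorem card_below_fullSupport_le (hF : 1 ≤ F) (hG : 1 ≤ G)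
    (hf : ((below (support f) N).card : ℝ) ≤ F) (hg : ((below (support g) N).card : ℝ) ≤ G)
    {s : Finset (ℕ × ℕ)} {A D' : ℕ} (hs : ∀ k ∈ s, k.1 ≤ A ∧ k.2 ≤ D') :
    ((below (fullSupport s f g) N).card : ℝ) ≤ s.card * (F ^ A * G ^ D') :=
  card_below_le_of_subset s (fun k => support (f ^ k.1 * g ^ k.2)) (fun _ h => h)
    fun k hk => card_below_pow_mul_pow_le_of_le hF hG hf hg (hs k hk).1 (hs k hk).2

end Counting

end BetaSeries

/-! ### Choice of parameters and the contradiction -/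

namespace BetaSeries

open Polynomial Filter Asymptotics

theorem eventually_mul_pow_lt_pow_ceil {β δ : ℝ} (hβ : 1 < β) (hδ : 0 < δ) (K : ℝ) (e : ℕ) :
    ∀ᶠ X : ℝ in atTop, K * X ^ e < β ^ ⌈X ^ δ⌉₊ := by
  have h1 := (isLittleO_rpow_exp_pos_mul_atTop ((e : ℝ) / δ) (Real.log_pos hβ)).comp_tendsto
    (tendsto_rpow_atTop hδ)
  have h2 := h1.def (c := 1 / (|K| + 1)) (by positivity)
  filter_upwards [h2, eventually_gt_atTop 0] with X hX hX0
  simp only [Function.comp_apply] at hX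
  rw [← Real.rpow_mul hX0.le, mul_div_cancel₀ _ hδ.ne', Real.rpow_natCast,
    Real.norm_of_nonneg (by positivity), Real.norm_of_nonneg (by positivity),
    div_mul_eq_mul_div, one_mul, le_div_iff₀ (by positivity)] at hX
  have hβ0 : 0 < β := by linarith
  calc K * X ^ e ≤ |K| * X ^ e := mul_le_mul_of_nonneg_right (le_abs_self K) (by positivity)
    _ < X ^ e * (|K| + 1) := by
        have : 0 < X ^ e := by positivity
        linarith
    _ ≤ Real.exp (Real.log β * X ^ δ) := hX
    _ = β ^ (X ^ δ) := (Real.rpow_def_of_pos hβ0 _).symm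
    _ ≤ β ^ ((⌈X ^ δ⌉₊ : ℕ) : ℝ) := Real.rpow_le_rpow_of_exponent_le hβ.le (Nat.le_ceil _)
    _ = β ^ ⌈X ^ δ⌉₊ := Real.rpow_natCast _ _

theorem eventually_mul_rpow_lt {θ : ℝ} (hθ : θ < 1) (K : ℝ) :
    ∀ᶠ X : ℝ in atTop, K * X ^ θ < X := by
  filter_upwards [(tendsto_rpow_atTop (sub_pos.2 hθ)).eventually_gt_atTop K,
    eventually_gt_atTop 0] with X hX hX0
  calc K * X ^ θ < X ^ (1 - θ) * X ^ θ := mul_lt_mul_of_pos_right hX (by positivity)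
    _ = X := by rw [← Real.rpow_add hX0, sub_add_cancel, Real.rpow_one]

-- With X = 2N + 1, M ≈ X^δ and h ≈ K X^E, each of the three terms in the gap count is O(X^(1-δ)),
-- which is less than N for large N.
set_option maxHeartbeats 1000000 in
theorem not_relation {β : ℝ} (hβ : 1 < β) (hint : IsIntegral ℤ β)
    (hconj : ∀ z : ℂ, IsConjRoot ℚ (β : ℂ) z → z ≠ (β : ℂ) → ‖z‖ ≤ 1)
    {f g : PowerSeries ℤ} (hf : NonnegCoeff f) (hg : NonnegCoeff g)
    (hfb : PolyBounded f) (hgb : PolyBounded g) {A D : ℕ} (hA : 1 ≤ A) (hD : 1 ≤ D)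
    {x E K : ℝ} (hx : 0 < x) (hE : 0 ≤ E) (hK : 0 < K) (hAx : A * x < 1)
    (hAE : ((A : ℝ) - 1) * x + E < 1)
    (hfcount : ∀ N : ℕ, 1 ≤ N → ((below (support f) N).card : ℝ) ≤ 2 * (N : ℝ) ^ x)
    (hfgap : ∀ y : ℕ, ∃ a ∈ support (f ^ A), a ≤ y ∧ (y : ℝ) - a + 1 ≤ K * ((y : ℝ) + 1) ^ E)
    (hgcount : ∀ ε : ℝ, 0 < ε → ∀ᶠ X : ℝ in atTop, (count (support g) X : ℝ) ≤ X ^ ε)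
    {C : ℕ} {r₀ : ℝ} (hC : 0 < C)
    (hmeets : ∀ r : ℝ, r₀ ≤ r → ∃ t ∈ support g, r ≤ t ∧ (t : ℝ) ≤ C * r)
    {s : Finset (ℕ × ℕ)} {q : ℕ × ℕ → ℤ[X]}
    (hs : ∀ k ∈ s, k.1 < A ∨ k.1 = A ∧ k.2 < D ∨ k = (A, D)) (htop : (A, D) ∈ s)
    (hq : aeval β (q (A, D)) ≠ 0)
    (hrel : ∑ k ∈ s, aeval β (q k) * (value f β⁻¹ ^ k.1 * value g β⁻¹ ^ k.2) = 0) : False := by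
  obtain ⟨B, e, hB, hbd⟩ := exists_bounds_head_relCoeff hβ hint hconj s q hfb hgb hrel
  set D' : ℕ := s.sup Prod.snd with hD'
  have hsD : ∀ k ∈ s, k.2 ≤ D' := fun k hk => Finset.le_sup (f := Prod.snd) hk
  have hsA : ∀ k ∈ s, k.1 ≤ A := by
    intro k hk
    rcases hs k hk with h | h | h
    · exact h.le
    · exact h.1.le
    · rw [h]
  -- Of the D' + 2 shares of slack, D' pay for the powers of g, one for the factor M, and one leaves
  -- the final saving X^(-δ). Lower terms may carry powers of g above D, hence D'.
  set δ : ℝ := min (1 - (((A : ℝ) - 1) * x + E)) (1 - A * x) / (D' + 2) with hδdef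
  have hδ : 0 < δ := div_pos (lt_min (by linarith) (by linarith)) (by positivity)
  have hδ' : δ * (D' + 2) = min (1 - (((A : ℝ) - 1) * x + E)) (1 - A * x) :=
    div_mul_cancel₀ _ (by positivity)
  have hδ₁ : δ * (D' + 2) ≤ 1 - (((A : ℝ) - 1) * x + E) := hδ'.trans_le (min_le_left _ _)
  have hδ₂ : δ * (D' + 2) ≤ 1 - A * x := hδ'.trans_le (min_le_right _ _)
  have hD0 : (0 : ℝ) ≤ δ * D' := by positivity
  have hA' : (1 : ℝ) ≤ A := by exact_mod_cast hA
  have hA1x : 0 ≤ ((A : ℝ) - 1) * x := mul_nonneg (by linarith) hx.le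
  set c := |aeval β (q (A, D))| with hc
  have hc0 : 0 < c := abs_pos.2 hq
  set n : ℝ := (s.card : ℝ) with hn
  set K₁ : ℝ := n * 2 ^ (A - 1) * (2 * (K + 1)) with hK₁
  set K₂ : ℝ := D * 2 ^ A * 8 with hK₂
  set K₃ : ℝ := (2 * C + 1) * (n * 2 ^ A * 2) with hK₃
  have hK₁0 : 0 ≤ K₁ := by positivity
  have hK₂0 : 0 ≤ K₂ := by positivity
  have hK₃0 : 0 ≤ K₃ := by positivity
  have hlim : Tendsto (fun N : ℕ => ((2 * N + 1 : ℕ) : ℝ)) atTop atTop :=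
    tendsto_natCast_atTop_atTop.comp (tendsto_atTop_mono (fun N => by simp; omega) tendsto_id)
  -- The factor 3 converts a bound by X into one by N, since X = 2N + 1 ≤ 3N.
  have ev₁ := eventually_mul_rpow_lt (θ := 1 - δ) (by linarith) (3 * (K₁ + K₂ + K₃ + K + 3))
  have ev₂ := hgcount δ hδ
  have ev₃ := eventually_mul_pow_lt_pow_ceil hβ hδ (B * 2 ^ e * (B * 2 ^ e)) (e + e)
  have ev₄ := eventually_mul_pow_lt_pow_ceil hβ hδ (B * 2 ^ e / c) e
  have ev₅ := (tendsto_rpow_atTop hδ).eventually_ge_atTop (2 * C * r₀)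
  obtain ⟨N, ⟨h₁, h₂, h₃, h₄, h₅⟩, hN⟩ := ((hlim.eventually
    (ev₁.and (ev₂.and (ev₃.and (ev₄.and ev₅))))).and (eventually_ge_atTop 1)).exists
  set X : ℝ := ((2 * N + 1 : ℕ) : ℝ) with hX
  have hXN : X = 2 * N + 1 := by rw [hX]; push_cast; ring
  have hN1 : (1 : ℝ) ≤ N := by exact_mod_cast hN
  have hX1 : 1 ≤ X := by linarith
  have hX0 : 0 < X := by linarith
  have hmono : ∀ {a b : ℝ}, a ≤ b → X ^ a ≤ X ^ b := Real.rpow_le_rpow_of_exponent_le hX1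
  have hpow1 : ∀ {a : ℝ}, 0 ≤ a → 1 ≤ X ^ a := Real.one_le_rpow hX1
  set M : ℕ := ⌈X ^ δ⌉₊ with hM
  set h : ℕ := ⌈K * X ^ E⌉₊ with hh
  have hMle : (M : ℝ) ≤ 2 * X ^ δ := by
    have h1 := Nat.ceil_lt_add_one (a := X ^ δ) (by positivity)
    have h2 := hpow1 hδ.le
    linarith
  have hMge : X ^ δ ≤ M := Nat.le_ceil _
  have hM1 : 1 ≤ M := by exact_mod_cast (hpow1 hδ.le).trans hMge
  have hhle : (h : ℝ) ≤ (K + 1) * X ^ E := by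
    have h1 := Nat.ceil_lt_add_one (a := K * X ^ E) (by positivity)
    have h2 := hpow1 hE
    linarith
  have hY : 0 < X ^ (1 - δ) := by positivity
  have hN3 : (K₁ + K₂ + K₃ + K + 3) * X ^ (1 - δ) < N := by linarith
  have hδY : X ^ δ ≤ X ^ (1 - δ) := hmono (by linarith)
  have hEY : X ^ E ≤ X ^ (1 - δ) := hmono (by linarith)
  have hKY : 0 ≤ (K₁ + K₂ + K₃) * X ^ (1 - δ) := by positivity
  have hMN : M ≤ N := by
    have h1 : 0 ≤ (K + 1) * X ^ (1 - δ) := by positivity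
    have h2 : (M : ℝ) ≤ N := by linarith
    exact_mod_cast h2
  have hhN : h ≤ N := by
    have h1 : (K + 1) * X ^ E ≤ (K + 1) * X ^ (1 - δ) := mul_le_mul_of_nonneg_left hEY (by linarith)
    have h2 : (h : ℝ) ≤ N := by linarith
    exact_mod_cast h2
  have hF : 1 ≤ 2 * X ^ x := by linarith [hpow1 hx.le]
  have hG := hpow1 hδ.le
  have hfc := hfcount (2 * N + 1) (by omega)
  have hgc : ((below (support g) (2 * N + 1)).card : ℝ) ≤ X ^ δ := by
    rw [card_below_eq_count]
    exact h₂
  have cE := card_below_lowSupport_le hF hG hfc hgc hsD (A := A)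
  have cW := card_below_midSupport_le hF hG hfc hgc (hsD _ htop) (A := A)
  have cU := card_below_fullSupport_le hF hG hfc hgc fun k hk => ⟨hsA k hk, hsD k hk⟩
  have key := le_card_of_consecutive_gaps (E := lowSupport s f g A) (W := midSupport f g A D)
    (U := fullSupport s f g) (N := N) (h := h) (l := 4 * M) (M := M) (C := 2 * C + 1)
    (by omega) ?_ hhN hMN ?_
  · have hkey : (N : ℝ) ≤ (below (lowSupport s f g A) (2 * N + 1)).card * (2 * h) +
        (below (midSupport f g A D) (2 * N + 1)).card * (4 * M) +
        (2 * C + 1) * ((below (fullSupport s f g) (2 * N + 1)).card * M) := by exact_mod_cast key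
    have hFA : (2 * X ^ x) ^ A * (X ^ δ) ^ D' * X ^ δ ≤ 2 ^ A * X ^ (1 - δ) := by
      rw [mul_pow, mul_assoc, mul_assoc, ← Real.rpow_natCast (X ^ x), ← Real.rpow_natCast (X ^ δ),
        ← Real.rpow_mul hX0.le, ← Real.rpow_mul hX0.le, ← Real.rpow_add hX0, ← Real.rpow_add hX0]
      exact mul_le_mul_of_nonneg_left (hmono (by linarith)) (by positivity)
    have hFA1 : (2 * X ^ x) ^ (A - 1) * (X ^ δ) ^ D' * X ^ E ≤ 2 ^ (A - 1) * X ^ (1 - δ) := by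
      rw [mul_pow, mul_assoc, mul_assoc, ← Real.rpow_natCast (X ^ x), ← Real.rpow_natCast (X ^ δ),
        ← Real.rpow_mul hX0.le, ← Real.rpow_mul hX0.le, ← Real.rpow_add hX0, ← Real.rpow_add hX0,
        Nat.cast_sub hA, Nat.cast_one]
      exact mul_le_mul_of_nonneg_left (hmono (by linarith)) (by positivity)
    have t₁ : ((below (lowSupport s f g A) (2 * N + 1)).card : ℝ) * (2 * h) ≤ K₁ * X ^ (1 - δ) :=
      calc _ ≤ n * ((2 * X ^ x) ^ (A - 1) * (X ^ δ) ^ D') * (2 * ((K + 1) * X ^ E)) := by gcongr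
        _ = n * (2 * (K + 1)) * ((2 * X ^ x) ^ (A - 1) * (X ^ δ) ^ D' * X ^ E) := by ring
        _ ≤ n * (2 * (K + 1)) * (2 ^ (A - 1) * X ^ (1 - δ)) := by gcongr
        _ = _ := by rw [hK₁]; ring
    have t₂ : ((below (midSupport f g A D) (2 * N + 1)).card : ℝ) * (4 * M) ≤ K₂ * X ^ (1 - δ) :=
      calc _ ≤ D * ((2 * X ^ x) ^ A * (X ^ δ) ^ D') * (4 * (2 * X ^ δ)) := by gcongr
        _ = D * 8 * ((2 * X ^ x) ^ A * (X ^ δ) ^ D' * X ^ δ) := by ring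
        _ ≤ D * 8 * (2 ^ A * X ^ (1 - δ)) := by gcongr
        _ = _ := by rw [hK₂]; ring
    have t₃ : (2 * (C : ℝ) + 1) * ((below (fullSupport s f g) (2 * N + 1)).card * M) ≤
        K₃ * X ^ (1 - δ) :=
      calc _ ≤ (2 * (C : ℝ) + 1) * (n * ((2 * X ^ x) ^ A * (X ^ δ) ^ D') * (2 * X ^ δ)) := by gcongr
        _ = (2 * C + 1) * (n * 2) * ((2 * X ^ x) ^ A * (X ^ δ) ^ D' * X ^ δ) := by ring
        _ ≤ (2 * C + 1) * (n * 2) * (2 ^ A * X ^ (1 - δ)) := by gcongr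
        _ = _ := by rw [hK₃]; ring
    have : 0 < (K + 3) * X ^ (1 - δ) := by positivity
    linarith
  · intro y hy
    obtain ⟨a, ha, hay, hya⟩ := hfgap y
    -- Taking j = 0 shows S(f^A) ⊆ W; this is where D ≥ 1 is needed.
    refine ⟨a, ⟨0, hD, by simpa using ha⟩, hay, ?_⟩
    have h1 : (y : ℝ) + 1 ≤ X := by
      have : (y : ℝ) ≤ 2 * N := by exact_mod_cast hy
      linarith
    have h2 : K * ((y : ℝ) + 1) ^ E ≤ K * X ^ E := by gcongr
    have h3 : K * X ^ E ≤ h := Nat.le_ceil _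
    have h4 : (y : ℝ) < a + h := by linarith
    exact_mod_cast h4
  · intro w w' R hw hw' hw'N hfree hww' hwR hR
    -- The range 3N is needed because gaps may end at 2N and M ≤ N further steps are examined.
    have hP : ∀ R ≤ 3 * N, B * ((R : ℝ) + 1) ^ e ≤ B * (2 * X) ^ e := by
      intro R hR
      have h1 : (R : ℝ) ≤ 3 * N := by exact_mod_cast hR
      have h2 : (R : ℝ) + 1 ≤ 2 * X := by linarith
      gcongr
    refine exists_mem_fullSupport_of_gap hβ hf hg hs htop (N := 3 * N) (P := B * (2 * X) ^ e) hC
      hmeets (fun R hR => (hbd R).1.trans (hP R hR)) (fun R hR hne => ((hbd R).2 hne).trans ?_)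
      ?_ ?_ (l := 4 * M) (by omega) ?_ hw (by omega) hfree hww' hwR hR
    · exact mul_le_mul_of_nonneg_left (hP R hR) (abs_nonneg _)
    · convert h₃ using 1
      rw [mul_pow]
      ring
    · rw [div_mul_eq_mul_div, div_lt_iff₀ hc0] at h₄
      rw [mul_pow, ← mul_assoc, mul_comm c]
      exact h₄
    · push_cast
      linarith

end BetaSeries

/-! ### The condition on ρ, denominators in ℚ(β), and the class of g -/

namespace BetaSeries

open Polynomial Filter Asymptotics

/-- With A = B + 1 this amounts to (B + 1)^B ≤ B^(B + 1), true from B = 3 on; the induction uses B(B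
+ 2) ≤ (B + 1)^2. It yields σ_A ≤ 1/A. -/
theorem G_inv_nonneg {A : ℕ} (hA : 4 ≤ A) : 0 ≤ G A (A : ℝ)⁻¹ := by
  obtain ⟨B, rfl⟩ : ∃ B, A = B + 1 := ⟨A - 1, by omega⟩
  have hB : 3 ≤ B := by omega
  have key : ((B : ℝ) + 1) ^ B ≤ (B : ℝ) ^ (B + 1) := by
    clear hA
    induction B, hB using Nat.le_induction with
    | base => norm_num
    | succ B hB ih =>
      have hB0 : (0 : ℝ) < B := by exact_mod_cast (by omega : 0 < B)
      push_cast
      have h1 : ((B : ℝ) * (B + 1 + 1)) ^ (B + 1) ≤ (((B : ℝ) + 1) ^ 2) ^ (B + 1) :=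
        pow_le_pow_left₀ (by positivity) (by nlinarith) _
      have h2 : (((B : ℝ) + 1) ^ 2) ^ (B + 1) = ((B : ℝ) + 1) ^ B * ((B : ℝ) + 1) ^ (B + 1 + 1) := by
        rw [← pow_mul, ← pow_add]
        congr 1
        ring
      have h3 := mul_le_mul_of_nonneg_right ih (by positivity : 0 ≤ ((B : ℝ) + 1) ^ (B + 1 + 1))
      rw [mul_pow, h2] at h1
      exact le_of_mul_le_mul_left (h1.trans h3) (by positivity)
  have hB1 : (0 : ℝ) < (B : ℝ) + 1 := by positivity
  unfold G
  push_cast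
  have e1 : 1 - ((B : ℝ) + 1)⁻¹ = B / (B + 1) := by field_simp; ring
  have e2 : ((B : ℝ) + 1 - 1) * ((B : ℝ) + 1)⁻¹ - 1 = -((B : ℝ) + 1) ^ B / (B + 1) ^ (B + 1) := by
    rw [pow_succ]
    field_simp
    ring
  rw [e1, add_sub_assoc, e2, div_pow, ← add_div]
  exact div_nonneg (by linarith) (by positivity)

/-- Strict convexity puts G_A below its chord between the zeros 0 and σ_A. -/
theorem G_neg_of_lt_sigma {A : ℕ} (hA : 3 ≤ A) {x : ℝ} (hx0 : 0 < x) (hx : x < sigma A) :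
    G A x < 0 := by
  obtain ⟨⟨h0, h1⟩, hG⟩ := sigma_spec hA
  set y := sigma A with hy
  have hsc := (strictConvexOn_pow (n := A) (by omega)).2
    (show (1 : ℝ) ∈ Set.Ici 0 by simp) (show (1 - y) ∈ Set.Ici (0 : ℝ) by
      simp only [Set.mem_Ici]; linarith) (by linarith : (1 : ℝ) ≠ 1 - y)
    (show 0 < 1 - x / y by rw [sub_pos, div_lt_one h0]; exact hx)
    (show 0 < x / y by positivity) (by ring)
  simp only [smul_eq_mul, one_pow, mul_one] at hsc
  have e1 : 1 - x / y + x / y * (1 - y) = 1 - x := by field_simp; ring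
  unfold G at hG ⊢
  have e2 : (1 - y) ^ A = 1 - ((A : ℝ) - 1) * y := by linarith
  have e3 : x / y * (1 - ((A : ℝ) - 1) * y) = x / y - ((A : ℝ) - 1) * x := by field_simp
  rw [e1, e2, e3] at hsc
  linarith

/-- The last inequality is G_A(1/ρ) < 0. For A ≤ 3 it follows from A/ρ < 1; for A ≥ 4 the
implication is reversed, because σ_A ≤ 1/A. -/
theorem exponent_bounds {A : ℕ} (hA : 0 < A) {ρ : ℝ} (hρ_small : A ≤ 3 → (A : ℝ) < ρ)
    (hρ_large : 4 ≤ A → (sigma A)⁻¹ < ρ) :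
    1 < ρ ∧ (A : ℝ) * ρ⁻¹ < 1 ∧ ((A : ℝ) - 1) * ρ⁻¹ + (1 - ρ⁻¹) ^ A < 1 := by
  rcases le_or_gt A 3 with h | h
  · have h1 := hρ_small h
    have hA1 : (1 : ℝ) ≤ A := by exact_mod_cast hA
    have hρ : 1 < ρ := by linarith
    have hx0 : 0 < ρ⁻¹ := by positivity
    have hAx : (A : ℝ) * ρ⁻¹ < 1 := by rwa [← div_eq_mul_inv, div_lt_one (by linarith)]
    refine ⟨hρ, hAx, ?_⟩
    set x := ρ⁻¹ with hx
    have hx1 : x < 1 := inv_lt_one_of_one_lt₀ hρ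
    interval_cases A
    · norm_num; linarith
    · norm_num at hAx ⊢; nlinarith
    · norm_num at hAx ⊢
      nlinarith [mul_pos hx0 hx0, mul_pos hx0 (by linarith : 0 < 1 - 3 * x)]
  · obtain ⟨⟨h0, h1⟩, hG⟩ := sigma_spec (by omega : 3 ≤ A)
    have h2 := hρ_large h
    have hρ : 1 < ρ := (one_lt_inv₀ h0).2 h1 |>.trans h2
    have hx : ρ⁻¹ < sigma A := inv_lt_of_inv_lt₀ h0 h2
    have hA0 : (0 : ℝ) < A := by exact_mod_cast hA
    refine ⟨hρ, ?_, ?_⟩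
    · have h3 : sigma A ≤ (A : ℝ)⁻¹ := by
        by_contra! hlt
        exact absurd (G_neg_of_lt_sigma (by omega) (inv_pos.2 hA0) hlt)
          (not_lt.2 (G_inv_nonneg h))
      have h4 := mul_lt_mul_of_pos_left (hx.trans_le h3) hA0
      rwa [mul_inv_cancel₀ hA0.ne'] at h4
    · have := G_neg_of_lt_sigma (by omega : 3 ≤ A) (inv_pos.2 (by linarith)) hx
      unfold G at this
      linarith

theorem exists_int_mul_eq_aeval {β : ℝ} (hβ : IsIntegral ℚ β)
    (z : IntermediateField.adjoin ℚ ({β} : Set ℝ)) :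
    ∃ d : ℤ, d ≠ 0 ∧ ∃ p : ℤ[X], aeval β p = d * (z : ℝ) := by
  have hz : (z : ℝ) ∈ (IntermediateField.adjoin ℚ ({β} : Set ℝ)).toSubalgebra := z.2
  rw [IntermediateField.adjoin_simple_toSubalgebra_of_isAlgebraic hβ.isAlgebraic,
    Algebra.adjoin_singleton_eq_range_aeval] at hz
  obtain ⟨P, hP⟩ := hz
  obtain ⟨d, hd, h⟩ := IsLocalization.integerNormalization_spec (nonZeroDivisors ℤ) P
  refine ⟨d, nonZeroDivisors.ne_zero hd, IsLocalization.integerNormalization (nonZeroDivisors ℤ) P, ?_⟩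
  rw [← hP, ← aeval_map_algebraMap ℚ β, h]
  simp [Algebra.smul_def]

theorem exists_common_int_mul_eq_aeval {ι : Type*} {β : ℝ} (hβ : IsIntegral ℚ β) (s : Finset ι)
    (c : ι → IntermediateField.adjoin ℚ ({β} : Set ℝ)) :
    ∃ d : ℤ, d ≠ 0 ∧ ∀ i ∈ s, ∃ p : ℤ[X], aeval β p = d * (c i : ℝ) := by
  classical
  induction s using Finset.induction_on with
  | empty => exact ⟨1, one_ne_zero, by simp⟩
  | insert i s hi ih =>
    obtain ⟨d, hd, ih⟩ := ih
    obtain ⟨d', hd', p', hp'⟩ := exists_int_mul_eq_aeval hβ (c i)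
    refine ⟨d' * d, mul_ne_zero hd' hd, fun j hj => ?_⟩
    rcases Finset.mem_insert.1 hj with rfl | hj
    · exact ⟨C d * p', by simp [hp']; ring⟩
    · obtain ⟨p, hp⟩ := ih j hj
      exact ⟨C d' * p, by simp [hp]; ring⟩

theorem InClassF.exists_mem_support_near {g : PowerSeries ℤ} (hg : InClassF g) :
    ∃ (C : ℕ) (r₀ : ℝ), 0 < C ∧ ∀ r : ℝ, r₀ ≤ r → ∃ t ∈ support g, r ≤ t ∧ (t : ℝ) ≤ C * r := by
  obtain ⟨C, hC, h⟩ := hg.meets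
  obtain ⟨r₀, h⟩ := eventually_atTop.1 h
  refine ⟨⌈C⌉₊, max r₀ 0, Nat.ceil_pos.2 hC, fun r hr => ?_⟩
  obtain ⟨_, ⟨h1, h2⟩, t, ht, rfl⟩ := h r ((le_max_left _ _).trans hr)
  exact ⟨t, ht, h1, h2.trans
    (mul_le_mul_of_nonneg_right (Nat.le_ceil C) ((le_max_right _ _).trans hr))⟩

theorem InClassF.eventually_count_le {g : PowerSeries ℤ} (hg : InClassF g) (ε : ℝ) (hε : 0 < ε) :
    ∀ᶠ X : ℝ in atTop, (count (support g) X : ℝ) ≤ X ^ ε := by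
  filter_upwards [(hg.sparse ε hε).def one_pos, eventually_gt_atTop 0] with X hX hX0
  rwa [one_mul, Real.norm_of_nonneg (by positivity), Real.norm_of_nonneg (by positivity)] at hX

end BetaSeries

theorem mainTheorem4 (A : ℕ) (hA : 0 < A) (ρ : ℝ)
    (hρ_small : A ≤ 3 → (A : ℝ) < ρ)
    (hρ_large : 4 ≤ A → (BetaSeries.sigma A)⁻¹ < ρ)
    (g : PowerSeries ℤ) (hg : BetaSeries.InClassF g)
    (β : ℝ) (hβ : BetaSeries.IsPisot β ∨ BetaSeries.IsSalem β) :
    LinearIndependent (IntermediateField.adjoin ℚ ({β} : Set ℝ))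
      (fun k : Fin (A + 1) × ℕ =>
        BetaSeries.gamma ρ β⁻¹ ^ (k.1 : ℕ) * BetaSeries.value g β⁻¹ ^ k.2) := by
  classical
  obtain ⟨hint, hβ1, hconj⟩ : IsIntegral ℤ β ∧ 1 < β ∧
      ∀ z : ℂ, IsConjRoot ℚ (β : ℂ) z → z ≠ (β : ℂ) → ‖z‖ ≤ 1 := by
    rcases hβ with ⟨h1, h2, h3⟩ | ⟨h1, h2, h3, -⟩
    · exact ⟨h1, h2, fun z hz hne => (h3 z hz hne).le⟩
    · exact ⟨h1, h2, h3⟩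
  obtain ⟨hρ, hAx, hAE⟩ := BetaSeries.exponent_bounds hA hρ_small hρ_large
  have hx0 : 0 < ρ⁻¹ := by positivity
  have hx1 : ρ⁻¹ < 1 := inv_lt_one_of_one_lt₀ hρ
  have hf : BetaSeries.NonnegCoeff (BetaSeries.gammaSeries ρ) := fun n =>
    (BetaSeries.coeff_gammaSeries_bounds ρ n).1
  have hfb := BetaSeries.PolyBounded.of_bounded (BetaSeries.coeff_gammaSeries_bounds ρ)
  obtain ⟨B, hgB⟩ := hg.bounded
  have hgn : BetaSeries.NonnegCoeff g := fun n => (hgB n).1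
  have hgb := BetaSeries.PolyBounded.of_bounded hgB
  obtain ⟨K, hK, hgap⟩ := BetaSeries.exists_mem_support_pow_near hf (by linarith : 0 < ρ + 1)
    (BetaSeries.exists_mem_support_gammaSeries_near hρ.le) (by linarith : 0 ≤ 1 - ρ⁻¹) A
  obtain ⟨C, r₀, hC, hmeets⟩ := hg.exists_mem_support_near
  rw [← BetaSeries.value_gammaSeries hρ.le, linearIndependent_iff']
  intro s c hsum i hi
  by_contra hci
  obtain ⟨d, hd, hq⟩ := BetaSeries.exists_common_int_mul_eq_aeval hint.tower_top s c
  choose! q hq using hq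
  set s' := s.filter fun k => c k ≠ 0 with hs'
  -- The leading term has the largest power of γ, and among those the largest power of g.
  obtain ⟨k₀, hk₀, hmax⟩ := s'.exists_max_image (fun k => toLex k)
    ⟨i, Finset.mem_filter.2 ⟨hi, hci⟩⟩
  have hk₀A : (k₀.1 : ℕ) ≤ A := Nat.lt_succ_iff.1 k₀.1.2
  -- Multiplying the relation by γ^(A - k₀.1) g raises the leading γ-exponent to A and makes the
  -- leading g-exponent positive.
  obtain ⟨e, he⟩ : ∃ e : Fin (A + 1) × ℕ ↪ ℕ × ℕ, ∀ k, e k = ((k.1 : ℕ) + (A - k₀.1), k.2 + 1) := by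
    refine ⟨⟨fun k => ((k.1 : ℕ) + (A - k₀.1), k.2 + 1), ?_⟩, fun _ => rfl⟩
    rintro ⟨a, b⟩ ⟨a', b'⟩ h
    simp only [Prod.mk.injEq, add_left_inj] at h
    rw [Fin.ext h.1, h.2]
  have hek₀ : e k₀ = (A, k₀.2 + 1) := by
    rw [he, Nat.add_sub_cancel' hk₀A]
  have hqe : ∀ k, Function.extend e q 0 (e k) = q k := e.injective.extend_apply q 0
  refine BetaSeries.not_relation hβ1 hint hconj hf hgn hfb hgb hA (D := k₀.2 + 1) (by omega) hx0
    (by positivity : 0 ≤ (1 - ρ⁻¹) ^ A) hK hAx hAE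
    (fun N hN => BetaSeries.card_below_gammaSeries_le hρ.le hN)
    (fun y => by simpa using hgap y) hg.eventually_count_le hC hmeets (s := s'.map e)
    (q := Function.extend e q 0) ?_ ?_ ?_ ?_
  · intro _ hmem
    obtain ⟨k, hk, rfl⟩ := Finset.mem_map.1 hmem
    rw [he]
    rcases (Prod.Lex.le_iff.1 (hmax k hk)) with h | ⟨h, h'⟩
    · left
      have h1 : (k.1 : ℕ) < k₀.1 := h
      change (k.1 : ℕ) + (A - k₀.1) < A
      omega
    · right
      have h1 : k.1 = k₀.1 := h
      have h2 : k.2 ≤ k₀.2 := h'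
      simp only [h1, Prod.mk.injEq]
      omega
  · rw [← hek₀]
    exact Finset.mem_map_of_mem e hk₀
  · obtain ⟨h1, h2⟩ := Finset.mem_filter.1 hk₀
    rw [← hek₀, hqe, hq _ h1]
    exact mul_ne_zero (by exact_mod_cast hd) (by simpa using h2)
  · rw [Finset.sum_map]
    set F := BetaSeries.value (BetaSeries.gammaSeries ρ) β⁻¹
    set V := BetaSeries.value g β⁻¹
    have h1 : ∑ k ∈ s', (c k : ℝ) * (F ^ (k.1 : ℕ) * V ^ k.2) = 0 := by
      rw [← hsum, hs', Finset.sum_filter_of_ne]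
      · rfl
      · rintro k - h h0
        rw [h0] at h
        simp at h
    calc _ = ∑ k ∈ s', (d : ℝ) * (F ^ (A - k₀.1) * V) * ((c k : ℝ) * (F ^ (k.1 : ℕ) * V ^ k.2)) := by
          refine Finset.sum_congr rfl fun k hk => ?_
          rw [hqe, hq k (Finset.mem_filter.1 hk).1]
          rw [he]
          ring
      _ = 0 := by rw [← Finset.mul_sum, h1, mul_zero]
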